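/- Let $\alpha,\beta>0$ and $\epsilon\in[0,1]$. There are constants $c,C>0$, depending only on $\alpha,\beta,\epsilon$, such that the following holds. Let $\Omega\subset\mathbb R^2$ be a bounded open convex domain, and let $A=(a_{ij}):\Omega\to\mathbb R^{2\times 2}$ be measurable and symmetric with $$\alpha\,\xi^T\xi\le \xi^TA(x)\xi\le\beta\,\xi^T\xi\quad(\xi\in\mathbb R^2,\ x\in\Omega),\qquad \frac{|A|^2}{(\operatorname{tr}A)^2}\le\frac1{1+\epsilon}\quad\text{in }\Omega\ \text{(Cordes condition)},$$ where $|A|^2=\sum_{i,j}a_{ij}^2$. Let $\mathcal T_h$ be a finite conforming triangulation of $\overline\Omega$ (so that $\Omega$ is a polygon) with set of vertices $\mathcal N_h$; let $V_h$ be the space of continuous functions on $\overline\Omega$ that are affine on each triangle, $\phi_{\mathbf z}\in V_h$ the nodal shape function of $\mathbf z\in\mathcal N_h$, and $V_h^0=\{v_h\in V_h: v_h|_{\partial\Omega}=0\}$. For each $\mathbf z\in\mathcal N_h$ let a finite set of sampling points in $\overline\Omega$ be given on which no nonzero polynomial of degree at most $2$ vanishes identically. For $v_h\in V_h$ let $p_{\mathbf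 z}$ be the polynomial of degree at most $2$ that is the discrete least-squares fit of $v_h$ on the sampling points of $\mathbf z$, and let $G_hv_h=\sum_{\mathbf z\in\mathcal N_h}\nabla p_{\mathbf z}(\mathbf z)\,\phi_{\mathbf z}\in V_h\times V_h$ (polynomial preserving recovery of the gradient). Let $$V_h^{0,0}=\{v_h\in V_h^0:\ \text{the tangential trace of }G_hv_h\text{ on }\partial\Omega\text{ vanishes}\},$$ and, with $\operatorname{rot}\mathbf w=\partial_yw_1-\partial_xw_2$, $(D\mathbf w)_{ij}=\partial_iw_j$ and $A:B=\sum_{i,j}a_{ij}b_{ij}$, $$a_{1,h}(v_h,w_h)=\sum_{T\in\mathcal T_h}\int_T\big[(A:DG_hv_h)(A:DG_hw_h)+(\operatorname{rot}G_hv_h)(\operatorname{rot}G_hw_h)\big]\,dx\,dy,\qquad \|v_h\|_{a,1}=a_{1,h}(v_h,v_h)^{1/2}.$$ Assume that the mesh is regular enough that the discrete Poincaré inequality $\|v_h\|_{H^i(\Omega)}\le C_P\|G_hv_h\|_{H^i(\Omega)}$ holds for all $v_h\in V_h^0$ and $i=0,1$, with some constant $C_P$. Then for every $f\in L^2(\Omega)$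 the gradient recovery based linear (GRBL) scheme is uniquely solvable: there is exactly one $u_h\in V_h^{0,0}$ with $$a_{1,h}(u_h,v_h)=(f,\,A:DG_hv_h)_{L^2(\Omega)}\qquad\text{for all }v_h\in V_h^{0,0}.$$ Moreover, the energy seminorm is equivalent to $\|DG_hv_h\|_{L^2(\Omega)}$ on $V_h^{0,0}$: $$c\,\|DG_hv_h\|_{L^2(\Omega)}\le\|v_h\|_{a,1}\le C\,\|DG_hv_h\|_{L^2(\Omega)}\qquad\text{for all }v_h\in V_h^{0,0}.$$ -/

import Mathlib

open MeasureTheory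

noncomputable section

namespace RecoveryFEM

/-- The plane `ℝ²` with its Euclidean structure. -/
abbrev Plane : Type := EuclideanSpace ℝ (Fin 2)

/-! ### Triangulations and linear finite elements -/

/-- A (conforming) triangulation of `Ω`: a finite geometric simplicial complex, all of whose maximal
faces are triangles and whose closed triangles cover exactly the closure of `Ω`. -/
structure Triangulation (Ω : Set Plane) extends Geometry.SimplicialComplex ℝ Plane where
  finite_faces : faces.Finite
  exists_triangle : ∀ s ∈ faces, ∃ t ∈ faces, s ⊆ t ∧ t.card = 3
  space_eq : toSimplicialComplex.space = closure Ω

namespace Triangulation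

variable {Ω : Set Plane} (𝒯 : Triangulation Ω)

/-- The triangles, each given by its three vertices. -/
def triangles : Finset (Finset Plane) :=
  𝒯.finite_faces.toFinset.filter fun t => t.card = 3

theorem mem_triangles {t : Finset Plane} : t ∈ 𝒯.triangles ↔ t ∈ 𝒯.faces ∧ t.card = 3 := by
  simp [triangles]

theorem finite_vertices : 𝒯.toSimplicialComplex.vertices.Finite :=
  𝒯.finite_faces.preimage (Finset.singleton_injective.injOn)

/-- The set of vertices of the triangulation. -/
def nodes : Finset Plane := 𝒯.finite_vertices.toFinset

theorem mem_nodes {z : Plane} : z ∈ 𝒯.nodes ↔ {z} ∈ 𝒯.faces := by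
  simp [nodes, Geometry.SimplicialComplex.mem_vertices]

/-- The `C⁰` linear finite element space `V_h`: functions that are continuous on the closure of `Ω`
and affine on each closed triangle. A function on the closure of `Ω` is represented by its
extension by zero to the plane. -/
def feSpace : Set (Plane → ℝ) :=
  {v | ContinuousOn v (closure Ω) ∧
    (∀ t ∈ 𝒯.triangles, ∃ l : Plane →ᵃ[ℝ] ℝ, Set.EqOn v l (convexHull ℝ (t : Set Plane))) ∧
    ∀ x, x ∉ closure Ω → v x = 0}

/-- The space `V_h^0` of finite element functions that vanish on the boundary. -/
def feSpaceZero : Set (Plane → ℝ) :=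
  {v | v ∈ 𝒯.feSpace ∧ ∀ x ∈ frontier Ω, v x = 0}

theorem mem_closure_iff {x : Plane} :
    x ∈ closure Ω ↔ ∃ t ∈ 𝒯.triangles, x ∈ convexHull ℝ (t : Set Plane) := by
  rw [← 𝒯.space_eq, Geometry.SimplicialComplex.mem_space_iff]
  constructor
  · rintro ⟨s, hs, hx⟩
    obtain ⟨t, ht, hst, hc⟩ := 𝒯.exists_triangle s hs
    exact ⟨t, 𝒯.mem_triangles.2 ⟨ht, hc⟩, convexHull_mono (Finset.coe_subset.2 hst) hx⟩
  · rintro ⟨t, ht, hx⟩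
    exact ⟨t, (𝒯.mem_triangles.1 ht).1, hx⟩

theorem eqOn_convexHull {s : Set Plane} {l l' : Plane →ᵃ[ℝ] ℝ} (h : Set.EqOn l l' s) :
    Set.EqOn l l' (convexHull ℝ s) := by
  have hconv : Convex ℝ {x | l x = l' x} := by
    intro x hx y hy a b ha hb hab
    simp only [Set.mem_ofPred_eq] at *
    rw [Convex.combo_affine_apply hab, Convex.combo_affine_apply hab, hx, hy]
  exact convexHull_min h hconv

theorem exists_affine {t : Finset Plane} (ht : t ∈ 𝒯.triangles) (g : Plane → ℝ) :
    ∃ l : Plane →ᵃ[ℝ] ℝ, ∀ y ∈ t, l y = g y := by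
  obtain ⟨hf, hc⟩ := 𝒯.mem_triangles.1 ht
  have hind := 𝒯.indep hf
  have htop : affineSpan ℝ (Set.range ((↑) : t → Plane)) = ⊤ := by
    rw [hind.affineSpan_eq_top_iff_card_eq_finrank_add_one]
    simp [hc]
  let b : AffineBasis t ℝ Plane := ⟨(↑), hind, htop⟩
  refine ⟨∑ y : t, g y • b.coord y, fun y hy => ?_⟩
  have h1 : ∀ i : t, b.coord i y = if i = ⟨y, hy⟩ then 1 else 0 := by
    intro i
    exact b.coord_apply i ⟨y, hy⟩
  have h2 : ∀ s : Finset t, (∑ i ∈ s, g i • b.coord i) y = ∑ i ∈ s, g i * b.coord i y := by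
    intro s
    induction s using Finset.induction_on with
    | empty => simp
    | insert a s ha ih => rw [Finset.sum_insert ha, Finset.sum_insert ha, ← ih]; simp
  rw [h2]
  simp [h1]

/-- Nodal values determine a unique finite element function. -/
theorem existsUnique_nodal (g : Plane → ℝ) :
    ∃! w : Plane → ℝ, w ∈ 𝒯.feSpace ∧ ∀ z ∈ 𝒯.nodes, w z = g z := by
  classical
  have hnode : ∀ t ∈ 𝒯.triangles, ∀ y ∈ t, y ∈ 𝒯.nodes := fun t ht y hy =>
    𝒯.mem_nodes.2 (𝒯.down_closed (𝒯.mem_triangles.1 ht).1 (Finset.singleton_subset_iff.2 hy)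
      (Finset.singleton_nonempty y))
  choose! l hl using fun t (ht : t ∈ 𝒯.triangles) => 𝒯.exists_affine ht g
  have hcomp : ∀ s ∈ 𝒯.triangles, ∀ t ∈ 𝒯.triangles, ∀ x ∈ convexHull ℝ (s : Set Plane),
      x ∈ convexHull ℝ (t : Set Plane) → l s x = l t x := by
    intro s hs t ht x hxs hxt
    refine eqOn_convexHull (s := (s ∩ t : Set Plane)) ?_ (𝒯.inter_subset_convexHull
      (𝒯.mem_triangles.1 hs).1 (𝒯.mem_triangles.1 ht).1 ⟨hxs, hxt⟩)
    rintro y ⟨hys, hyt⟩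
    rw [hl s hs y hys, hl t ht y hyt]
  let w : Plane → ℝ := fun x =>
    if h : ∃ t ∈ 𝒯.triangles, x ∈ convexHull ℝ (t : Set Plane) then l h.choose x else 0
  have hw : ∀ t ∈ 𝒯.triangles, Set.EqOn w (l t) (convexHull ℝ (t : Set Plane)) := by
    intro t ht x hx
    have h : ∃ t ∈ 𝒯.triangles, x ∈ convexHull ℝ (t : Set Plane) := ⟨t, ht, hx⟩
    simp only [w, dif_pos h]
    exact hcomp _ h.choose_spec.1 _ ht _ h.choose_spec.2 hx
  refine ⟨w, ⟨⟨?_, fun t ht => ⟨l t, hw t ht⟩, fun x hx => ?_⟩, fun z hz => ?_⟩, ?_⟩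
  · have hU : closure Ω = ⋃ t : 𝒯.triangles, convexHull ℝ (t.1 : Set Plane) := by
      ext x
      simp [𝒯.mem_closure_iff]
    rw [hU]
    refine (locallyFinite_of_finite _).continuousOn_iUnion (fun t => ?_) (fun t => ?_)
    · exact (t.1.finite_toSet.isCompact_convexHull ℝ).isClosed
    · exact ((l t.1).continuous_of_finiteDimensional.continuousOn).congr (hw t.1 t.2)
  · have h : ¬ ∃ t ∈ 𝒯.triangles, x ∈ convexHull ℝ (t : Set Plane) := by
      rwa [← 𝒯.mem_closure_iff]
    simp only [w, dif_neg h]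
  · obtain ⟨t, ht, hzt, hc⟩ := 𝒯.exists_triangle _ (𝒯.mem_nodes.1 hz)
    have hzt' : z ∈ t := hzt (Finset.mem_singleton_self z)
    have ht' := 𝒯.mem_triangles.2 ⟨ht, hc⟩
    rw [hw t ht' (subset_convexHull ℝ _ hzt'), hl t ht' z hzt']
  · rintro v ⟨⟨-, hv, hv0⟩, hvg⟩
    funext x
    by_cases hx : x ∈ closure Ω
    · obtain ⟨t, ht, hxt⟩ := 𝒯.mem_closure_iff.1 hx
      obtain ⟨m, hm⟩ := hv t ht
      rw [hm hxt, hw t ht hxt]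
      refine eqOn_convexHull (fun y hy => ?_) hxt
      rw [← hm (subset_convexHull ℝ _ hy), hvg y (hnode t ht y hy), hl t ht y hy]
    · have h : ¬ ∃ t ∈ 𝒯.triangles, x ∈ convexHull ℝ (t : Set Plane) := by
        rwa [← 𝒯.mem_closure_iff]
      rw [hv0 x hx]
      simp only [w, dif_neg h]

open Classical in
/-- The nodal shape function `φ_z`: the finite element function with value `1` at `z` and `0` at all
other vertices. -/
def shape (z : Plane) : Plane → ℝ :=
  (𝒯.existsUnique_nodal fun y => if y = z then 1 else 0).choose

end Triangulation

/-! ### Polynomial preserving recovery of the gradient -/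

/-- Real polynomials in two variables of total degree at most two. -/
abbrev quadratics : Submodule ℝ (MvPolynomial (Fin 2) ℝ) :=
  MvPolynomial.restrictTotalDegree (Fin 2) ℝ 2

/-- The value of a polynomial at a point of the plane. -/
def polyVal (p : MvPolynomial (Fin 2) ℝ) (x : Plane) : ℝ := MvPolynomial.eval (fun i => x i) p

/-- A quadratic polynomial is determined by its values on the finite set `P`. -/
def Unisolvent (P : Finset Plane) : Prop :=
  ∀ p ∈ quadratics, (∀ x ∈ P, polyVal p x = 0) → p = 0

/-- The quadratic polynomial `p` is the discrete least-squares fit of `v` on the points `P`. -/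
def IsQuadraticFit (P : Finset Plane) (v : Plane → ℝ) (p : MvPolynomial (Fin 2) ℝ) : Prop :=
  p ∈ quadratics ∧ ∀ q ∈ quadratics, ∑ x ∈ P, (polyVal p x - v x) * polyVal q x = 0

theorem existsUnique_quadraticFit {P : Finset Plane} (hP : Unisolvent P) (v : Plane → ℝ) :
    ∃! p, IsQuadraticFit P v p := by
  let ev (x : Plane) : quadratics →ₗ[ℝ] ℝ :=
    (MvPolynomial.aeval (fun i => x i)).toLinearMap ∘ₗ quadratics.subtype
  have hev : ∀ x (p : quadratics), ev x p = polyVal p x := fun x p => by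
    simp [ev, polyVal, MvPolynomial.aeval_eq_eval]
  let L : quadratics →ₗ[ℝ] Module.Dual ℝ quadratics := ∑ x ∈ P, (ev x).smulRight (ev x)
  have hL : ∀ p q, L p q = ∑ x ∈ P, polyVal p x * polyVal q x := fun p q => by
    simp [L, LinearMap.sum_apply, hev]
  have hinj : Function.Injective L := by
    rw [injective_iff_map_eq_zero]
    intro p hp
    have h0 : ∑ x ∈ P, polyVal p x * polyVal p x = 0 := by rw [← hL, hp]; rfl
    rw [Finset.sum_eq_zero_iff_of_nonneg fun x _ => mul_self_nonneg _] at h0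
    exact Subtype.ext (hP p p.2 fun x hx => mul_self_eq_zero.1 (h0 x hx))
  have hsurj : Function.Surjective L :=
    (LinearMap.injective_iff_surjective_of_finrank_eq_finrank
      (Subspace.dual_finrank_eq (K := ℝ) (V := quadratics)).symm).1 hinj
  obtain ⟨p, hp⟩ := hsurj (∑ x ∈ P, v x • ev x)
  have hp' : ∀ q ∈ quadratics, ∑ x ∈ P, polyVal p x * polyVal q x = ∑ x ∈ P, v x * polyVal q x := by
    intro q hq
    have h := congrArg (fun φ => φ ⟨q, hq⟩) hp
    simpa [hL, LinearMap.sum_apply, hev] using h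
  refine ⟨p, ⟨p.2, fun q hq => ?_⟩, fun r hr => ?_⟩
  · simp only [sub_mul, Finset.sum_sub_distrib, hp' q hq, sub_self]
  · have : L ⟨r, hr.1⟩ = L p := by
      ext q
      have h := hr.2 q q.2
      simp only [sub_mul, Finset.sum_sub_distrib, sub_eq_zero] at h
      rw [hL, hL, h, hp' q q.2]
    exact congrArg Subtype.val (hinj this)

variable {Ω : Set Plane} {𝒯 : Triangulation Ω}

/-- The sampling points of polynomial preserving recovery: for each vertex `z`, finitely many points
of the mesh domain that determine quadratic polynomials. They may lie in the element patch of `z`,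
or in a larger patch, as is customary near the boundary. -/
structure Sampling (𝒯 : Triangulation Ω) where
  pts : 𝒯.nodes → Finset Plane
  pts_subset : ∀ z, (pts z : Set Plane) ⊆ closure Ω
  unisolvent : ∀ z, Unisolvent (pts z)

/-- The quadratic polynomial fitted to `v` at the vertex `z`. -/
def Sampling.fit (S : Sampling 𝒯) (v : Plane → ℝ) (z : 𝒯.nodes) : MvPolynomial (Fin 2) ℝ :=
  (existsUnique_quadraticFit (S.unisolvent z) v).choose

/-- The recovered gradient `G_h v = ∑_z ∇p_z(z) φ_z`, as a pair of components. -/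
def Sampling.grad (S : Sampling 𝒯) (v : Plane → ℝ) : Fin 2 → Plane → ℝ := fun i x =>
  ∑ z : 𝒯.nodes, polyVal (MvPolynomial.pderiv i (S.fit v z)) z * 𝒯.shape z x

/-! ### Differential operators and norms -/

/-- The partial derivative `∂_i v`. For finite element functions it is defined in the interior of
each triangle, hence almost everywhere in `Ω`. -/
def partialDeriv (i : Fin 2) (v : Plane → ℝ) (x : Plane) : ℝ :=
  fderiv ℝ v x (EuclideanSpace.single i 1)

/-- The matrix `(D w)_{ij} = ∂_i w_j`. -/
def jac (w : Fin 2 → Plane → ℝ) (x : Plane) : Matrix (Fin 2) (Fin 2) ℝ :=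
  Matrix.of fun i j => partialDeriv i (w j) x

/-- `rot w = ∂_y w_1 - ∂_x w_2`. -/
def rot (w : Fin 2 → Plane → ℝ) (x : Plane) : ℝ :=
  partialDeriv 1 (w 0) x - partialDeriv 0 (w 1) x

/-- The Frobenius product `A : B`. -/
def frob (A B : Matrix (Fin 2) (Fin 2) ℝ) : ℝ := ∑ i, ∑ j, A i j * B i j

/-- The `L²(Ω)` norm of a scalar or vector field, given by its components. -/
def norm0 {ι : Type} [Fintype ι] (Ω : Set Plane) (w : ι → Plane → ℝ) : ℝ :=
  Real.sqrt (∑ k, ∫ x in Ω, w k x ^ 2)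

/-- The `H¹(Ω)` norm of a scalar or vector field, given by its components. -/
def norm1 {ι : Type} [Fintype ι] (Ω : Set Plane) (w : ι → Plane → ℝ) : ℝ :=
  Real.sqrt (∑ k, ∫ x in Ω, (w k x ^ 2 + ∑ i, partialDeriv i (w k) x ^ 2))

/-- The norm `‖D w‖_{L²(Ω)}`. -/
def normJac (Ω : Set Plane) (w : Fin 2 → Plane → ℝ) : ℝ :=
  Real.sqrt (∫ x in Ω, frob (jac w x) (jac w x))

/-- The tangential trace of `w` vanishes on the boundary of a polygon `Ω`: on every segment that lies
in the boundary, `w` is orthogonal to the direction of the segment. -/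
def TangentialTraceZero (Ω : Set Plane) (w : Fin 2 → Plane → ℝ) : Prop :=
  ∀ p q : Plane, segment ℝ p q ⊆ frontier Ω →
    ∀ x ∈ segment ℝ p q, ∑ i, w i x * (q i - p i) = 0

/-! ### The gradient recovery based linear finite element scheme -/

/-- The space `V_h^{0,0}`. -/
def Sampling.spaceZeroZero (S : Sampling 𝒯) : Set (Plane → ℝ) :=
  {v | v ∈ 𝒯.feSpaceZero ∧ TangentialTraceZero Ω (S.grad v)}

/-- The discrete Poincaré inequality `‖v_h‖_i ≲ ‖G_h v_h‖_i` on `V_h^0`, for `i = 0, 1`. -/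
def Sampling.DiscretePoincare (S : Sampling 𝒯) : Prop :=
  ∃ C : ℝ, ∀ v ∈ 𝒯.feSpaceZero,
    norm0 Ω (fun _ : Unit => v) ≤ C * norm0 Ω (S.grad v) ∧
    norm1 Ω (fun _ : Unit => v) ≤ C * norm1 Ω (S.grad v)

/-- The bilinear form `a_{1,h}`. -/
def Sampling.form (S : Sampling 𝒯) (A : Plane → Matrix (Fin 2) (Fin 2) ℝ) (v w : Plane → ℝ) : ℝ :=
  ∑ t ∈ 𝒯.triangles, ∫ x in convexHull ℝ (t : Set Plane),
    (frob (A x) (jac (S.grad v) x) * frob (A x) (jac (S.grad w) x) +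
      rot (S.grad v) x * rot (S.grad w) x)

/-- The energy seminorm `‖v‖_{a,1}`. -/
def Sampling.energy (S : Sampling 𝒯) (A : Plane → Matrix (Fin 2) (Fin 2) ℝ) (v : Plane → ℝ) : ℝ :=
  Real.sqrt (S.form A v v)

/-- `u` solves the scheme: `u ∈ V_h^{0,0}` and `a_{1,h}(u, v) = (f, A : D G_h v)` for all
`v ∈ V_h^{0,0}`. -/
def Sampling.IsSolution (S : Sampling 𝒯) (A : Plane → Matrix (Fin 2) (Fin 2) ℝ) (f : Plane → ℝ)
    (u : Plane → ℝ) : Prop :=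
  u ∈ S.spaceZeroZero ∧ ∀ v ∈ S.spaceZeroZero,
    S.form A u v = ∫ x in Ω, f x * frob (A x) (jac (S.grad v) x)

/-- Coefficients on `Ω` that are measurable, symmetric, uniformly elliptic with bounds `α, β`, and
satisfy the Cordes condition with parameter `ε` in dimension `d = 2`. -/
structure IsCordesCoefficient (Ω : Set Plane) (α β ε : ℝ)
    (A : Plane → Matrix (Fin 2) (Fin 2) ℝ) : Prop where
  aemeasurable : ∀ i j, AEMeasurable (fun x => A x i j) (volume.restrict Ω)
  symm : ∀ x ∈ Ω, (A x).IsSymm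
  elliptic : ∀ x ∈ Ω, ∀ ξ : Fin 2 → ℝ,
    α * (ξ ⬝ᵥ ξ) ≤ ξ ⬝ᵥ (A x).mulVec ξ ∧ ξ ⬝ᵥ (A x).mulVec ξ ≤ β * (ξ ⬝ᵥ ξ)
  cordes : ∀ x ∈ Ω, frob (A x) (A x) / (A x).trace ^ 2 ≤ 1 / (2 - 1 + ε)

end RecoveryFEM

end

/-!
On a triangle, the integral of the null Lagrangian `det DW` of an affine field `W` is a sum over the
edges of cross products of vertex values. Contributions of interior edges cancel between the two
adjacent triangles; on a boundary edge both vertex values are normal to the edge, hence parallel. So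
`∫ det DW = 0` for `W` with vanishing tangential trace. By Cayley-Hamilton, a symmetric `2 × 2`
matrix `S` satisfies `A : S² = (tr S) (A : S) - (tr A) det S`; with ellipticity this bounds `|DW|²`
by `A : DW` and `rot W` up to a multiple of `det DW`, and integration makes the energy coercive.

If the energy vanishes, the recovered gradient is a constant vector normal to every side of the
polygon, hence zero, and the Poincaré inequality gives `v = 0`. Definiteness on the
finite-dimensional space `V_h^{0,0}` yields unique solvability.
-/

noncomputable section

namespace RecoveryFEM

open Filter Topology

section SupportingHyperplane

variable {E : Type*} [AddCommGroup E] [Module ℝ E] [TopologicalSpace E]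
  {s t : Set E} {a b x : E}

theorem le_of_mem_closure_of_forall_lt {f : E →L[ℝ] ℝ} {M : ℝ} (hf : ∀ y ∈ s, f y < M)
    (hx : x ∈ closure s) : f x ≤ M :=
  closure_minimal (fun y hy => (hf y hy).le) (isClosed_le f.continuous continuous_const) hx

variable [IsTopologicalAddGroup E] [ContinuousSMul ℝ E]

theorem segment_subset_frontier_of_apply_eq (hs : Convex ℝ s) {f : E →L[ℝ] ℝ} {M : ℝ}
    (hf : ∀ y ∈ s, f y < M) (ha : a ∈ closure s) (hb : b ∈ closure s) (hfa : f a = M)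
    (hfb : f b = M) : segment ℝ a b ⊆ frontier s := by
  intro y hy
  have hfy : f y = M :=
    (convex_hyperplane f.toLinearMap.isLinear M).segment_subset hfa hfb hy
  exact ⟨hs.closure.segment_subset ha hb hy, fun h => (hf y (interior_subset h)).ne hfy⟩

theorem segment_subset_frontier_of_midpoint_notMem (ho : IsOpen s) (hs : Convex ℝ s)
    (ha : a ∈ closure s) (hb : b ∈ closure s) (hm : midpoint ℝ a b ∉ s) :
    segment ℝ a b ⊆ frontier s := by
  obtain ⟨f, hf⟩ := geometric_hahn_banach_open_point hs ho hm
  have hfa := le_of_mem_closure_of_forall_lt hf ha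
  have hfb := le_of_mem_closure_of_forall_lt hf hb
  have hfm : f (midpoint ℝ a b) = (f a + f b) / 2 := by
    simp only [midpoint_eq_smul_add, map_smul, map_add, smul_eq_mul, invOf_eq_inv]
    ring
  exact segment_subset_frontier_of_apply_eq hs hf ha hb (by linarith) (by linarith)

theorem exists_segment_subset_frontier (ho : IsOpen s) (hs : Convex ℝ s) (hts : t ⊆ closure s)
    (hx : x ∈ convexHull ℝ t) (hxs : x ∉ s) : ∃ a ∈ t, segment ℝ a x ⊆ frontier s := by
  obtain ⟨f, hf⟩ := geometric_hahn_banach_open_point hs ho hxs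
  have hconv : ConvexOn ℝ Set.univ f := f.toLinearMap.convexOn convex_univ
  obtain ⟨a, ha, hxa⟩ := hconv.exists_ge_of_mem_convexHull (Set.subset_univ t) hx
  have hax := le_of_mem_closure_of_forall_lt hf (hts ha)
  exact ⟨a, ha, segment_subset_frontier_of_apply_eq hs hf (hts ha)
    (convexHull_min hts hs.closure hx) (hax.antisymm hxa) rfl⟩

end SupportingHyperplane

theorem exists_add_smul_mem_frontier {E : Type*} [NormedAddCommGroup E] [NormedSpace ℝ E]
    {s : Set E} (hs : Bornology.IsBounded s) {y d : E} (hy : y ∈ s) (hd : d ≠ 0) :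
    ∃ r : ℝ, y + r • d ∈ frontier s := by
  let line : ℝ → E := fun r => y + r • d
  obtain ⟨R, hR⟩ := isBounded_iff_forall_norm_le.1 hs
  have hline : Tendsto (fun r => ‖line r‖) atTop atTop := by
    refine tendsto_norm_atTop_atTop.comp tendsto_id |>.atTop_mul_const (norm_pos_iff.2 hd)
      |>.atTop_add (tendsto_const_nhds (x := -‖y‖)) |> tendsto_atTop_mono fun r => ?_
    have := norm_sub_norm_le (r • d) (-y)
    rw [norm_smul, norm_neg, sub_neg_eq_add, add_comm (r • d)] at this
    simpa [line] using this
  obtain ⟨r, hr⟩ := (hline.eventually_gt_atTop R).exists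
  have hfr : (frontier (line ⁻¹' s)).Nonempty :=
    nonempty_frontier_iff.2 ⟨⟨0, by simpa [line] using hy⟩,
      (Set.ne_univ_iff_exists_notMem _).2 ⟨r, fun h => (hR _ h).not_gt hr⟩⟩
  obtain ⟨r, hr⟩ := hfr
  exact ⟨r, (show Continuous line by fun_prop).frontier_preimage_subset s hr⟩

/-! ### Oriented areas -/

/-- The planar cross product, the determinant of the matrix with columns `u` and `v`. -/
def cross (u v : Plane) : ℝ := u 0 * v 1 - u 1 * v 0

/-- For two vertices `a, b` of the triangle `t` with third vertex `c`, this is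
`cross (b - a) (c - a)`, twice the oriented area of `a b c`: the summands at `a` and `b` vanish. -/
def orient (t : Finset Plane) (a b : Plane) : ℝ := ∑ c ∈ t, cross (b - a) (c - a)

theorem isLinearMap_cross (u : Plane) : IsLinearMap ℝ (cross u) :=
  ⟨fun v w => by simp only [cross, PiLp.add_apply]; ring,
    fun r v => by simp only [cross, PiLp.smul_apply, smul_eq_mul]; ring⟩

theorem cross_midpoint_add_smul (a b n : Plane) (r : ℝ) :
    cross (b - a) (midpoint ℝ a b + r • n - a) = r * cross (b - a) n := by
  rw [midpoint_eq_smul_add]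
  simp only [cross, PiLp.sub_apply, PiLp.add_apply, PiLp.smul_apply, smul_eq_mul, invOf_eq_inv]
  ring

theorem exists_eq_insert_pair {α : Type*} [DecidableEq α] {t : Finset α} {a b : α}
    (ht : t.card = 3) (ha : a ∈ t) (hb : b ∈ t) (hab : a ≠ b) :
    ∃ c, t = {a, b, c} ∧ a ≠ c ∧ b ≠ c := by
  have hba : b ∈ t.erase a := Finset.mem_erase.2 ⟨hab.symm, hb⟩
  obtain ⟨c, hc⟩ := Finset.card_eq_one.1 <| show ((t.erase a).erase b).card = 1 by
    rw [Finset.card_erase_of_mem hba, Finset.card_erase_of_mem ha, ht]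
  have hct : c ∈ (t.erase a).erase b := hc ▸ Finset.mem_singleton_self c
  simp only [Finset.mem_erase] at hct
  exact ⟨c, by rw [← hc, Finset.insert_erase hba, Finset.insert_erase ha], hct.2.1.symm,
    hct.1.symm⟩

theorem orient_triple {a b c : Plane} (hab : a ≠ b) (hac : a ≠ c) (hbc : b ≠ c) :
    orient {a, b, c} a b = cross (b - a) (c - a) := by
  rw [orient, Finset.sum_insert (by simp [hab, hac]), Finset.sum_pair hbc]
  simp only [cross, PiLp.sub_apply]
  ring

theorem orient_self (t : Finset Plane) (a : Plane) : orient t a a = 0 := by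
  simp [orient, cross]

theorem orient_swap {t : Finset Plane} {a b : Plane} (ht : t.card = 3) (ha : a ∈ t) (hb : b ∈ t) :
    orient t b a = - orient t a b := by
  rcases eq_or_ne a b with rfl | hab
  · simp [orient_self]
  obtain ⟨c, rfl, hac, hbc⟩ := exists_eq_insert_pair ht ha hb hab
  rw [orient_triple hab hac hbc, Finset.insert_comm, orient_triple hab.symm hbc hac]
  simp only [cross, PiLp.sub_apply]
  ring

theorem sum_sum_mul_sign_orient {F : Plane → Plane → ℝ} (hF : ∀ x y, F y x = -F x y)
    {a b c : Plane} (hab : a ≠ b) (hac : a ≠ c) (hbc : b ≠ c) :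
    ∑ x ∈ ({a, b, c} : Finset Plane), ∑ y ∈ ({a, b, c} : Finset Plane),
        F x y * SignType.sign (orient {a, b, c} x y) =
      2 * SignType.sign (cross (b - a) (c - a)) * (F a b + F b c + F c a) := by
  have ht : ({a, b, c} : Finset Plane).card = 3 :=
    Finset.card_eq_three.2 ⟨a, b, c, hab, hac, hbc, rfl⟩
  have hor_ab : orient {a, b, c} a b = cross (b - a) (c - a) := orient_triple hab hac hbc
  have hor_bc : orient {a, b, c} b c = cross (b - a) (c - a) := by
    rw [show ({a, b, c} : Finset Plane) = {b, c, a} by grind, orient_triple hbc hab.symm hac.symm]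
    simp only [cross, PiLp.sub_apply]; ring
  have hor_ca : orient {a, b, c} c a = cross (b - a) (c - a) := by
    rw [show ({a, b, c} : Finset Plane) = {c, a, b} by grind, orient_triple hac.symm hbc.symm hab]
    simp only [cross, PiLp.sub_apply]; ring
  have hor_ba := orient_swap (a := a) (b := b) ht (by simp) (by simp)
  have hor_cb := orient_swap (a := b) (b := c) ht (by simp) (by simp)
  have hor_ac := orient_swap (a := c) (b := a) ht (by simp) (by simp)
  have hsum (f : Plane → ℝ) : ∑ x ∈ ({a, b, c} : Finset Plane), f x = f a + (f b + f c) := by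
    rw [Finset.sum_insert (by simp [hab, hac]), Finset.sum_pair hbc]
  simp only [hsum, hor_ba, hor_cb, hor_ac, hor_ab, hor_bc, hor_ca, orient_self, sign_zero,
    Left.sign_neg, SignType.coe_neg, SignType.coe_zero, hF a b, hF b c, hF c a]
  ring

/-- The linear map sending the standard basis to `u`, `v`, which maps the reference triangle to the
triangle spanned by `u` and `v`. -/
def frameMap (u v : Plane) : Plane →ₗ[ℝ] Plane :=
  Matrix.toLin (EuclideanSpace.basisFun (Fin 2) ℝ).toBasis
    (EuclideanSpace.basisFun (Fin 2) ℝ).toBasis !![u 0, v 0; u 1, v 1]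

theorem frameMap_apply (u v x : Plane) : frameMap u v x = x 0 • u + x 1 • v := by
  ext i
  rw [frameMap, Matrix.toLin_apply]
  fin_cases i <;>
    simp [Matrix.mulVec, dotProduct, Fin.sum_univ_two] <;> ring

theorem det_frameMap (u v : Plane) : LinearMap.det (frameMap u v) = cross u v := by
  rw [frameMap, LinearMap.det_toLin, Matrix.det_fin_two_of, cross]
  ring

/-- The vertices of the reference triangle, of which every triangle is an affine image. -/
def refVertices : Set Plane := {0, EuclideanSpace.single 0 1, EuclideanSpace.single 1 1}

/-- The area of the reference triangle, a common factor of the areas of all triangles. -/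
def refArea : ℝ := volume.real (convexHull ℝ refVertices)

theorem convexHull_triple_eq_image (a b c : Plane) :
    convexHull ℝ {a, b, c} =
      (fun x => a + x) '' (frameMap (b - a) (c - a) '' convexHull ℝ refVertices) := by
  have hadd : (fun x : Plane => a + x) = (AffineEquiv.constVAdd ℝ Plane a).toAffineMap := by
    ext x; simp
  rw [LinearMap.image_convexHull, hadd, AffineMap.image_convexHull]
  simp [refVertices, Set.image_insert_eq, frameMap_apply]

theorem volume_real_triangle (a b c : Plane) :
    volume.real (convexHull ℝ {a, b, c}) = |cross (b - a) (c - a)| * refArea := by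
  rw [measureReal_def, convexHull_triple_eq_image, Set.image_add_left, measure_preimage_add,
    Measure.addHaar_image_linearMap, det_frameMap, ENNReal.toReal_mul,
    ENNReal.toReal_ofReal (abs_nonneg _), refArea, measureReal_def]

/-- The constant value `∂_i L_j` of the Jacobian of the affine field `L`, indexed like `jac`. -/
def affineJac (L : Fin 2 → Plane →ᵃ[ℝ] ℝ) : Matrix (Fin 2) (Fin 2) ℝ :=
  Matrix.of fun i j => (L j).linear (EuclideanSpace.single i 1)

theorem affine_apply_eq (L : Fin 2 → Plane →ᵃ[ℝ] ℝ) (j : Fin 2) (x y : Plane) :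
    L j y = L j x + affineJac L 0 j * (y 0 - x 0) + affineJac L 1 j * (y 1 - x 1) := by
  have hyx : y - x = (y 0 - x 0) • EuclideanSpace.single 0 1 +
      (y 1 - x 1) • (EuclideanSpace.single 1 1 : Plane) := by
    ext i; fin_cases i <;> simp
  have hL : L j y = (L j).linear (y - x) + L j x := by simpa using (L j).map_vadd x (y - x)
  rw [hL, hyx, map_add, map_smul, map_smul, smul_eq_mul, smul_eq_mul]
  simp only [affineJac, Matrix.of_apply]
  ring

/-- The cross product of the values of the field `W` at two points, the contribution of the oriented
edge `a b` to the integral of `det DW`. -/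
def valueCross (W : Fin 2 → Plane → ℝ) (a b : Plane) : ℝ := W 0 a * W 1 b - W 1 a * W 0 b

theorem valueCross_affine_sum (L : Fin 2 → Plane →ᵃ[ℝ] ℝ) (a b c : Plane) :
    valueCross (fun i => L i) a b + valueCross (fun i => L i) b c + valueCross (fun i => L i) c a =
      cross (b - a) (c - a) * (affineJac L).det := by
  simp only [valueCross, affine_apply_eq L 0 a b, affine_apply_eq L 0 a c,
    affine_apply_eq L 1 a b, affine_apply_eq L 1 a c, cross, PiLp.sub_apply, Matrix.det_fin_two]
  ring

theorem volume_real_mul_det_affineJac {t : Finset Plane} (ht : t.card = 3)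
    (L : Fin 2 → Plane →ᵃ[ℝ] ℝ) :
    volume.real (convexHull ℝ (t : Set Plane)) * (affineJac L).det =
      refArea / 2 *
        ∑ a ∈ t, ∑ b ∈ t, valueCross (fun i => L i) a b * SignType.sign (orient t a b) := by
  obtain ⟨a, b, c, hab, hac, hbc, rfl⟩ := Finset.card_eq_three.1 ht
  rw [sum_sum_mul_sign_orient (fun x y => by simp only [valueCross]; ring) hab hac hbc,
    valueCross_affine_sum]
  push_cast
  rw [volume_real_triangle, ← sign_mul_self (cross (b - a) (c - a))]
  ring

/-! ### Edges of the triangulation -/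

theorem mem_convexHull_triple {a b c x : Plane} (habc : 0 < cross (b - a) (c - a))
    (ha : 0 ≤ cross (b - x) (c - x)) (hb : 0 ≤ cross (c - x) (a - x))
    (hc : 0 ≤ cross (a - x) (b - x)) : x ∈ convexHull ℝ {a, b, c} := by
  let w : Fin 3 → ℝ := ![cross (b - x) (c - x), cross (c - x) (a - x), cross (a - x) (b - x)]
  have hw : ∑ i, w i = cross (b - a) (c - a) := by
    simp only [w, Fin.sum_univ_three, Matrix.cons_val, cross, PiLp.sub_apply]
    ring
  have hx : Finset.univ.centerMass w ![a, b, c] = x := by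
    rw [Finset.centerMass, hw, inv_smul_eq_iff₀ habc.ne']
    ext i
    fin_cases i <;> simp [Fin.sum_univ_three, w, cross] <;> ring
  rw [← hx]
  refine Finset.centerMass_mem_convexHull _ (fun i _ => ?_) (hw ▸ habc) fun i _ => ?_
  · fin_cases i <;> assumption
  · fin_cases i <;> simp

theorem eventually_mem_convexHull_triple {a b c n : Plane} (habc : 0 < cross (b - a) (c - a))
    (hn : 0 < cross (b - a) n) :
    ∀ᶠ r : ℝ in 𝓝[>] 0, midpoint ℝ a b + r • n ∈ convexHull ℝ {a, b, c} := by
  let x : ℝ → Plane := fun r => midpoint ℝ a b + r • n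
  have hx (r : ℝ) (i : Fin 2) : x r i = (a i + b i) / 2 + r * n i := by
    simp [x, midpoint_eq_smul_add]; ring
  have ha (r : ℝ) : cross (b - x r) (c - x r) =
      cross (b - a) (c - a) / 2 - r * cross n (c - b) := by
    simp only [cross, PiLp.sub_apply, hx]; ring
  have hb (r : ℝ) : cross (c - x r) (a - x r) =
      cross (b - a) (c - a) / 2 - r * cross n (a - c) := by
    simp only [cross, PiLp.sub_apply, hx]; ring
  have hc (r : ℝ) : cross (a - x r) (b - x r) = r * cross (b - a) n := by
    simp only [cross, PiLp.sub_apply, hx]; ring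
  have hpos (k : ℝ) : ∀ᶠ r : ℝ in 𝓝[>] 0, 0 < cross (b - a) (c - a) / 2 - r * k := by
    have hcont : Continuous fun r : ℝ => cross (b - a) (c - a) / 2 - r * k := by fun_prop
    refine ((hcont.tendsto 0).mono_left nhdsWithin_le_nhds).eventually_const_lt ?_
    simpa using habc
  filter_upwards [self_mem_nhdsWithin, hpos (cross n (c - b)), hpos (cross n (a - c))]
    with r hr hra hrb
  exact mem_convexHull_triple habc (ha r ▸ hra.le) (hb r ▸ hrb.le)
    (hc r ▸ (mul_pos hr hn).le)

theorem cross_nonpos_of_mem_convexHull {a b x : Plane} {s : Set Plane}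
    (hs : ∀ y ∈ s, cross (b - a) (y - a) ≤ 0) (hx : x ∈ convexHull ℝ s) :
    cross (b - a) (x - a) ≤ 0 := by
  have hlin := isLinearMap_cross (b - a)
  simp only [hlin.map_sub, sub_nonpos] at hs ⊢
  exact convexHull_min hs (convex_halfSpace_le hlin _) hx

namespace Triangulation

variable {Ω : Set Plane} (𝒯 : Triangulation Ω) {s t : Finset Plane} {a b : Plane}

theorem mem_nodes_of_mem (ht : t ∈ 𝒯.triangles) (ha : a ∈ t) : a ∈ 𝒯.nodes :=
  𝒯.mem_nodes.2 (𝒯.down_closed (𝒯.mem_triangles.1 ht).1 (Finset.singleton_subset_iff.2 ha)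
    (Finset.singleton_nonempty a))

theorem convexHull_subset_closure (ht : t ∈ 𝒯.triangles) :
    convexHull ℝ (t : Set Plane) ⊆ closure Ω := fun _ hx => 𝒯.mem_closure_iff.2 ⟨t, ht, hx⟩

theorem mem_closure_of_mem (ht : t ∈ 𝒯.triangles) (ha : a ∈ t) : a ∈ closure Ω :=
  𝒯.convexHull_subset_closure ht (subset_convexHull ℝ _ ha)

theorem interior_convexHull_nonempty (ht : t ∈ 𝒯.triangles) :
    (interior (convexHull ℝ (t : Set Plane))).Nonempty := by
  obtain ⟨hface, hcard⟩ := 𝒯.mem_triangles.1 ht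
  have hspan : affineSpan ℝ (Set.range ((↑) : t → Plane)) = ⊤ := by
    rw [(𝒯.indep hface).affineSpan_eq_top_iff_card_eq_finrank_add_one]
    simp [hcard]
  rw [interior_convexHull_nonempty_iff_affineSpan_eq_top]
  simpa using hspan

theorem cross_ne_zero {c : Plane} (h : ({a, b, c} : Finset Plane) ∈ 𝒯.triangles) :
    cross (b - a) (c - a) ≠ 0 := by
  intro h0
  have hvol : volume.real (convexHull ℝ {a, b, c}) = 0 := by
    rw [volume_real_triangle, h0, abs_zero, zero_mul]
  have hpos : 0 < volume (convexHull ℝ (({a, b, c} : Finset Plane) : Set Plane)) :=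
    Measure.measure_pos_of_nonempty_interior _ (𝒯.interior_convexHull_nonempty h)
  have hfin := (({a, b, c} : Finset Plane).finite_toSet.isCompact_convexHull ℝ).measure_lt_top
    (μ := volume)
  push_cast at hpos hfin
  exact (ENNReal.toReal_pos hpos.ne' hfin.ne).ne' hvol

theorem orient_ne_zero (ht : t ∈ 𝒯.triangles) (ha : a ∈ t) (hb : b ∈ t) (hab : a ≠ b) :
    orient t a b ≠ 0 := by
  obtain ⟨c, rfl, hac, hbc⟩ := exists_eq_insert_pair (𝒯.mem_triangles.1 ht).2 ha hb hab
  rw [orient_triple hab hac hbc]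
  exact 𝒯.cross_ne_zero ht

theorem mem_of_midpoint_mem (hs : s ∈ 𝒯.triangles) (ht : t ∈ 𝒯.triangles) (ha : a ∈ s)
    (hb : b ∈ s) (hab : a ≠ b) (hm : midpoint ℝ a b ∈ convexHull ℝ (t : Set Plane)) : a ∈ t := by
  by_contra hat
  have hedge : ({a, b} : Finset Plane) ∈ 𝒯.faces :=
    𝒯.down_closed (𝒯.mem_triangles.1 hs).1 (by simp [Finset.insert_subset_iff, ha, hb]) (by simp)
  have hmab : midpoint ℝ a b ∈ convexHull ℝ (({a, b} : Finset Plane) : Set Plane) := by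
    simpa [convexHull_pair] using midpoint_mem_segment a b
  have hsub : (({a, b} : Finset Plane) : Set Plane) ∩ t ⊆ {b} := by
    rintro y ⟨hy, hyt⟩
    have : y ≠ a := fun h => hat (h ▸ hyt)
    simpa [this] using hy
  have hmb := convexHull_mono hsub
    (𝒯.inter_subset_convexHull hedge (𝒯.mem_triangles.1 ht).1 ⟨hmab, hm⟩)
  rw [convexHull_singleton, Set.mem_singleton_iff, midpoint_eq_right_iff] at hmb
  exact hab hmb

theorem exists_mem_triangle_near (ho : IsOpen Ω) {m : Plane} (hm : m ∈ Ω) (n : Plane) :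
    ∃ t ∈ 𝒯.triangles, m ∈ convexHull ℝ (t : Set Plane) ∧
      ∃ r : ℝ, 0 < r ∧ m + r • n ∈ convexHull ℝ (t : Set Plane) := by
  have hfar : ∀ᶠ x in 𝓝 m, ∀ t ∈ 𝒯.triangles, m ∉ convexHull ℝ (t : Set Plane) →
      x ∉ convexHull ℝ (t : Set Plane) := by
    simp only [Filter.eventually_all_finset, Filter.eventually_imp_distrib_left]
    exact fun t _ h => (t.finite_toSet.isClosed_convexHull ℝ).isOpen_compl.eventually_mem h
  have hray : Tendsto (fun r : ℝ => m + r • n) (𝓝[>] 0) (𝓝 m) := by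
    have hcont : Continuous fun r : ℝ => m + r • n := by fun_prop
    simpa using (hcont.tendsto 0).mono_left nhdsWithin_le_nhds
  obtain ⟨r, ⟨hrΩ, hrt⟩, hr⟩ :=
    ((hray.eventually ((ho.eventually_mem hm).and hfar)).and self_mem_nhdsWithin).exists
  obtain ⟨t, ht, hxt⟩ := 𝒯.mem_closure_iff.1 (subset_closure hrΩ)
  exact ⟨t, ht, not_not.1 fun h => hrt t ht h hxt, r, hr, hxt⟩

theorem exists_orient_pos (ho : IsOpen Ω) (hs : s ∈ 𝒯.triangles) (ha : a ∈ s) (hb : b ∈ s)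
    (hab : a ≠ b) (hm : midpoint ℝ a b ∈ Ω) :
    ∃ t ∈ 𝒯.triangles, a ∈ t ∧ b ∈ t ∧ 0 < orient t a b := by
  rcases (𝒯.orient_ne_zero hs ha hb hab).lt_or_gt with hneg | hpos
  swap
  · exact ⟨s, hs, ha, hb, hpos⟩
  obtain ⟨c, rfl, hac, hbc⟩ := exists_eq_insert_pair (𝒯.mem_triangles.1 hs).2 ha hb hab
  rw [orient_triple hab hac hbc] at hneg
  obtain ⟨t, ht, hmt, r, hr, hxt⟩ := 𝒯.exists_mem_triangle_near ho hm (-(c - a))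
  have hat := 𝒯.mem_of_midpoint_mem hs ht ha hb hab hmt
  have hbt := 𝒯.mem_of_midpoint_mem hs ht hb ha hab.symm (by rwa [midpoint_comm])
  refine ⟨t, ht, hat, hbt, not_le.1 fun hle => ?_⟩
  obtain ⟨d, rfl, had, hbd⟩ := exists_eq_insert_pair (𝒯.mem_triangles.1 ht).2 hat hbt hab
  rw [orient_triple hab had hbd] at hle
  have hx := cross_nonpos_of_mem_convexHull (a := a) (b := b) (fun y hy => by
    simp only [Finset.coe_insert, Finset.coe_singleton] at hy
    rcases hy with rfl | rfl | rfl
    · simp [cross]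
    · simp [cross, mul_comm]
    · exact hle) hxt
  rw [cross_midpoint_add_smul, (isLinearMap_cross _).map_neg] at hx
  nlinarith [mul_neg_of_pos_of_neg hr hneg]

theorem eq_of_orient_pos (hs : s ∈ 𝒯.triangles) (ht : t ∈ 𝒯.triangles) (has : a ∈ s)
    (hbs : b ∈ s) (hat : a ∈ t) (hbt : b ∈ t) (hab : a ≠ b) (hos : 0 < orient s a b)
    (hot : 0 < orient t a b) : s = t := by
  obtain ⟨c, rfl, hac, hbc⟩ := exists_eq_insert_pair (𝒯.mem_triangles.1 hs).2 has hbs hab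
  obtain ⟨d, rfl, had, hbd⟩ := exists_eq_insert_pair (𝒯.mem_triangles.1 ht).2 hat hbt hab
  rw [orient_triple hab hac hbc] at hos
  rw [orient_triple hab had hbd] at hot
  by_contra hne
  have hcd : c ≠ d := fun h => hne (by rw [h])
  obtain ⟨r, ⟨hrs, hrt⟩, hr⟩ := ((eventually_mem_convexHull_triple hos hos).and
    (eventually_mem_convexHull_triple hot hos)).and self_mem_nhdsWithin |>.exists
  have hx := 𝒯.inter_subset_convexHull (𝒯.mem_triangles.1 hs).1 (𝒯.mem_triangles.1 ht).1
    ⟨by simpa using hrs, by simpa using hrt⟩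
  have hle := cross_nonpos_of_mem_convexHull (a := a) (b := b) (fun y hy => by
    obtain rfl | rfl : y = a ∨ y = b := by
      simp only [Finset.coe_insert, Finset.coe_singleton, Set.mem_inter_iff, Set.mem_insert_iff,
        Set.mem_singleton_iff] at hy
      grind
    · simp [cross]
    · simp [cross, mul_comm]) hx
  rw [cross_midpoint_add_smul] at hle
  exact (mul_pos hr hos).not_ge hle

theorem sum_sign_orient (ho : IsOpen Ω) (hs : s ∈ 𝒯.triangles) (ha : a ∈ s) (hb : b ∈ s)
    (hab : a ≠ b) (hm : midpoint ℝ a b ∈ Ω) :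
    ∑ t ∈ 𝒯.triangles with a ∈ t ∧ b ∈ t, (SignType.sign (orient t a b) : ℝ) = 0 := by
  obtain ⟨t, ht, hat, hbt, hot⟩ := 𝒯.exists_orient_pos ho hs ha hb hab hm
  obtain ⟨t', ht', hbt', hat', hot'⟩ :=
    𝒯.exists_orient_pos ho hs hb ha hab.symm (by rwa [midpoint_comm])
  have hneg : orient t' a b < 0 := by
    rw [orient_swap (𝒯.mem_triangles.1 ht').2 hbt' hat']
    exact neg_neg_of_pos hot'
  have htt' : t ≠ t' := by rintro rfl; exact hneg.not_gt hot
  have hpair : {u ∈ 𝒯.triangles | a ∈ u ∧ b ∈ u} = {t, t'} := by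
    ext u
    simp only [Finset.mem_filter, Finset.mem_insert, Finset.mem_singleton]
    refine ⟨fun ⟨hu, hau, hbu⟩ => ?_, ?_⟩
    · rcases (𝒯.orient_ne_zero hu hau hbu hab).lt_or_gt with h | h
      · refine .inr (𝒯.eq_of_orient_pos hu ht' hbu hau hbt' hat' hab.symm ?_ hot')
        rw [orient_swap (𝒯.mem_triangles.1 hu).2 hau hbu]
        exact neg_pos.2 h
      · exact .inl (𝒯.eq_of_orient_pos hu ht hau hbu hat hbt hab h hot)
    · rintro (rfl | rfl)
      exacts [⟨ht, hat, hbt⟩, ⟨ht', hat', hbt'⟩]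
  rw [hpair, Finset.sum_pair htt', sign_pos hot, sign_neg hneg]
  simp

theorem sum_mul_sign_orient_eq_zero (ho : IsOpen Ω) (hc : Convex ℝ Ω) {F : Plane → Plane → ℝ}
    (hF : ∀ a b, a ≠ b → segment ℝ a b ⊆ frontier Ω → F a b = 0) :
    ∑ t ∈ 𝒯.triangles, ∑ a ∈ t, ∑ b ∈ t, F a b * SignType.sign (orient t a b) = 0 := by
  have hedge (a b : Plane) : ∑ t ∈ 𝒯.triangles with a ∈ t ∧ b ∈ t,
      F a b * SignType.sign (orient t a b) = 0 := by
    rcases eq_or_ne a b with rfl | hab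
    · simp [orient_self]
    rcases Finset.eq_empty_or_nonempty {t ∈ 𝒯.triangles | a ∈ t ∧ b ∈ t} with hempty | ⟨s, hs⟩
    · rw [hempty, Finset.sum_empty]
    obtain ⟨hs, has, hbs⟩ := Finset.mem_filter.1 hs
    rw [← Finset.mul_sum]
    by_cases hm : midpoint ℝ a b ∈ Ω
    · rw [𝒯.sum_sign_orient ho hs has hbs hab hm, mul_zero]
    · rw [hF a b hab (segment_subset_frontier_of_midpoint_notMem ho hc
        (𝒯.mem_closure_of_mem hs has) (𝒯.mem_closure_of_mem hs hbs) hm), zero_mul]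
  calc ∑ t ∈ 𝒯.triangles, ∑ a ∈ t, ∑ b ∈ t, F a b * (SignType.sign (orient t a b) : ℝ)
      = ∑ t ∈ 𝒯.triangles, ∑ p ∈ t ×ˢ t, F p.1 p.2 * SignType.sign (orient t p.1 p.2) :=
        by simp only [Finset.sum_product]
    _ = ∑ p ∈ 𝒯.nodes ×ˢ 𝒯.nodes, ∑ t ∈ 𝒯.triangles with p.1 ∈ t ∧ p.2 ∈ t,
          F p.1 p.2 * SignType.sign (orient t p.1 p.2) := by
        refine Finset.sum_comm' fun t p => ?_
        simp only [Finset.mem_product, Finset.mem_filter]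
        exact ⟨fun ⟨ht, hp⟩ => ⟨⟨ht, hp⟩, 𝒯.mem_nodes_of_mem ht hp.1, 𝒯.mem_nodes_of_mem ht hp.2⟩,
          fun h => h.1⟩
    _ = 0 := Finset.sum_eq_zero fun p _ => hedge p.1 p.2

end Triangulation

theorem valueCross_eq_zero_of_segment_subset_frontier {Ω : Set Plane} {W : Fin 2 → Plane → ℝ}
    (hW : TangentialTraceZero Ω W) {a b : Plane} (hab : a ≠ b)
    (hseg : segment ℝ a b ⊆ frontier Ω) : valueCross W a b = 0 := by
  have ha := hW a b hseg a (left_mem_segment ℝ a b)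
  have hb := hW a b hseg b (right_mem_segment ℝ a b)
  rw [Fin.sum_univ_two] at ha hb
  by_contra hne
  refine hab (PiLp.ext fun i => (sub_eq_zero.1 ((mul_eq_zero.1 ?_).resolve_right hne)).symm)
  fin_cases i
  · simp only [valueCross, Fin.zero_eta]
    linear_combination W 1 b * ha - W 1 a * hb
  · simp only [valueCross, Fin.mk_one]
    linear_combination W 0 a * hb - W 0 b * ha

/-! ### Integration of finite element functions -/

theorem addHaar_convexHull_eq_zero_of_card_le_finrank {E : Type*} [NormedAddCommGroup E]
    [NormedSpace ℝ E] [FiniteDimensional ℝ E] [MeasurableSpace E] [BorelSpace E] (μ : Measure E)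
    [μ.IsAddHaarMeasure] {s : Finset E} (hs : s.card ≤ Module.finrank ℝ E) :
    μ (convexHull ℝ (s : Set E)) = 0 := by
  classical
  rcases s.eq_empty_or_nonempty with rfl | hne
  · simp
  refine measure_mono_null (convexHull_subset_affineSpan _)
    (Measure.addHaar_affineSubspace _ _ fun htop => ?_)
  have hspan := finrank_vectorSpan_image_finset_le ℝ (id : E → E) s (n := s.card - 1)
    (by have := hne.card_pos; omega)
  rw [Finset.image_id, ← direction_affineSpan, htop, AffineSubspace.direction_top,
    finrank_top] at hspan
  have := hne.card_pos
  omega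

namespace Triangulation

variable {Ω : Set Plane} (𝒯 : Triangulation Ω) {s t : Finset Plane}

theorem closure_eq_iUnion : closure Ω = ⋃ t : 𝒯.triangles, convexHull ℝ (t.1 : Set Plane) := by
  ext x
  simp [𝒯.mem_closure_iff]

include 𝒯 in
theorem isCompact_closure : IsCompact (closure Ω) := by
  rw [𝒯.closure_eq_iUnion]
  exact isCompact_iUnion fun t => t.1.finite_toSet.isCompact_convexHull ℝ

include 𝒯 in
theorem isFiniteMeasure_restrict : IsFiniteMeasure (volume.restrict Ω) :=
  MeasureTheory.isFiniteMeasure_restrict.2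
    ((measure_mono subset_closure).trans_lt 𝒯.isCompact_closure.measure_lt_top).ne

theorem volume_inter_eq_zero (hs : s ∈ 𝒯.triangles) (ht : t ∈ 𝒯.triangles) (hst : s ≠ t) :
    volume (convexHull ℝ (s : Set Plane) ∩ convexHull ℝ (t : Set Plane)) = 0 := by
  obtain ⟨hsf, hsc⟩ := 𝒯.mem_triangles.1 hs
  obtain ⟨htf, htc⟩ := 𝒯.mem_triangles.1 ht
  have hcard : (s ∩ t).card < 3 := by
    rw [← hsc]
    refine Finset.card_lt_card (Finset.inter_subset_left.ssubset_of_ne fun h => hst ?_)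
    exact Finset.eq_of_subset_of_card_le (Finset.inter_eq_left.1 h) (htc.trans hsc.symm).le
  refine measure_mono_null (𝒯.inter_subset_convexHull hsf htf) ?_
  rw [← Finset.coe_inter]
  exact addHaar_convexHull_eq_zero_of_card_le_finrank volume
    (by rw [finrank_euclideanSpace_fin]; omega)

theorem ae_eq_iUnion (hc : Convex ℝ Ω) :
    Ω =ᵐ[volume] ⋃ t : 𝒯.triangles, convexHull ℝ (t.1 : Set Plane) := by
  rw [← 𝒯.closure_eq_iUnion]
  exact (closure_ae_eq_of_null_frontier (hc.addHaar_frontier volume)).symm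

theorem sum_setIntegral (hc : Convex ℝ Ω) {F : Plane → ℝ} (hF : IntegrableOn F Ω) :
    ∑ t ∈ 𝒯.triangles, ∫ x in convexHull ℝ (t : Set Plane), F x = ∫ x in Ω, F x := by
  have hae := 𝒯.ae_eq_iUnion hc
  rw [setIntegral_congr_set hae, integral_iUnion_ae, tsum_fintype,
    ← Finset.sum_coe_sort 𝒯.triangles]
  · exact fun t => (t.1.finite_toSet.isClosed_convexHull ℝ).measurableSet.nullMeasurableSet
  · exact fun s t hst => 𝒯.volume_inter_eq_zero s.2 t.2 (Subtype.coe_ne_coe.2 hst)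
  · exact hF.congr_set_ae hae.symm

theorem ae_mem_interior (hc : Convex ℝ Ω) :
    ∀ᵐ x ∂(volume.restrict Ω), ∃ t ∈ 𝒯.triangles, x ∈ interior (convexHull ℝ (t : Set Plane)) := by
  rw [Measure.restrict_congr_set (𝒯.ae_eq_iUnion hc), ae_restrict_iUnion_iff]
  rintro ⟨t, ht⟩
  rw [Measure.restrict_congr_set (interior_ae_eq_of_null_frontier
    ((convex_convexHull ℝ _).addHaar_frontier volume)).symm]
  filter_upwards [ae_restrict_mem isOpen_interior.measurableSet] with x hx using ⟨t, ht, hx⟩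

/-- The finite element space `V_h` as a linear subspace of the functions on the plane; its elements
vanish off the closure of `Ω`. -/
def feSubmodule : Submodule ℝ (Plane → ℝ) where
  carrier := 𝒯.feSpace
  zero_mem' := ⟨continuousOn_const, fun _ _ => ⟨0, fun x _ => by simp⟩, fun _ _ => rfl⟩
  add_mem' {v w} hv hw := by
    refine ⟨hv.1.add hw.1, fun t ht => ?_, fun x hx => by simp [hv.2.2 x hx, hw.2.2 x hx]⟩
    obtain ⟨l, hl⟩ := hv.2.1 t ht
    obtain ⟨m, hm⟩ := hw.2.1 t ht
    exact ⟨l + m, fun x hx => by simp [hl hx, hm hx]⟩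
  smul_mem' r v hv := by
    refine ⟨hv.1.const_smul r, fun t ht => ?_, fun x hx => by simp [hv.2.2 x hx]⟩
    obtain ⟨l, hl⟩ := hv.2.1 t ht
    exact ⟨r • l, fun x hx => by simp [hl hx]⟩

theorem shape_mem_feSpace (z : Plane) : 𝒯.shape z ∈ 𝒯.feSpace :=
  (Exists.choose_spec (𝒯.existsUnique_nodal _)).1.1

variable {𝒯}

theorem eq_zero_of_nodes {v : Plane → ℝ} (hv : v ∈ 𝒯.feSpace) (h : ∀ z ∈ 𝒯.nodes, v z = 0) :
    v = 0 :=
  (𝒯.existsUnique_nodal 0).unique ⟨hv, h⟩ ⟨𝒯.feSubmodule.zero_mem, fun _ _ => rfl⟩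

end Triangulation

section AffineOnSet

variable {s : Set Plane} {x : Plane}

theorem hasFDerivAt_of_eqOn {v : Plane → ℝ} {l : Plane →ᵃ[ℝ] ℝ} (h : Set.EqOn v l s)
    (hx : x ∈ interior s) : HasFDerivAt v (LinearMap.toContinuousLinearMap l.linear) x := by
  have hl : HasFDerivAt l (LinearMap.toContinuousLinearMap l.linear) x := by
    rw [l.decomp]
    exact (LinearMap.toContinuousLinearMap l.linear).hasFDerivAt.add_const (l 0)
  exact hl.congr_of_eventuallyEq (h.eventuallyEq_of_mem (mem_interior_iff_mem_nhds.1 hx))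

theorem partialDeriv_of_eqOn {v : Plane → ℝ} {l : Plane →ᵃ[ℝ] ℝ} (h : Set.EqOn v l s)
    (hx : x ∈ interior s) (i : Fin 2) :
    partialDeriv i v x = l.linear (EuclideanSpace.single i 1) := by
  rw [partialDeriv, (hasFDerivAt_of_eqOn h hx).fderiv]
  rfl

theorem jac_of_eqOn {W : Fin 2 → Plane → ℝ} {L : Fin 2 → Plane →ᵃ[ℝ] ℝ}
    (h : ∀ i, Set.EqOn (W i) (L i) s) (hx : x ∈ interior s) : jac W x = affineJac L := by
  ext i j
  exact partialDeriv_of_eqOn (h j) hx i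

theorem setIntegral_det_jac_of_eqOn {t : Finset Plane} (ht : t.card = 3) {W : Fin 2 → Plane → ℝ}
    {L : Fin 2 → Plane →ᵃ[ℝ] ℝ} (h : ∀ i, Set.EqOn (W i) (L i) (convexHull ℝ t)) :
    ∫ x in convexHull ℝ t, (jac W x).det =
      refArea / 2 * ∑ a ∈ t, ∑ b ∈ t, valueCross W a b * SignType.sign (orient t a b) := by
  have hint := interior_ae_eq_of_null_frontier
    ((convex_convexHull ℝ (t : Set Plane)).addHaar_frontier volume)
  have hvertex (i : Fin 2) {a : Plane} (ha : a ∈ t) : W i a = L i a :=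
    h i (subset_convexHull ℝ _ ha)
  calc ∫ x in convexHull ℝ t, (jac W x).det
      = ∫ _ in interior (convexHull ℝ (t : Set Plane)), (affineJac L).det := by
        rw [← setIntegral_congr_set hint]
        exact setIntegral_congr_fun isOpen_interior.measurableSet fun x hx => by
          simp only [jac_of_eqOn h hx]
    _ = volume.real (convexHull ℝ (t : Set Plane)) * (affineJac L).det := by
        rw [setIntegral_const, smul_eq_mul, measureReal_congr hint]
    _ = _ := by
        rw [volume_real_mul_det_affineJac ht]
        congr 1
        refine Finset.sum_congr rfl fun a ha => Finset.sum_congr rfl fun b hb => ?_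
        simp only [valueCross, hvertex _ ha, hvertex _ hb]

end AffineOnSet

theorem measurable_partialDeriv (i : Fin 2) (v : Plane → ℝ) : Measurable (partialDeriv i v) :=
  measurable_fderiv_apply_const ℝ v _

namespace Triangulation

variable {Ω : Set Plane} {𝒯 : Triangulation Ω} {v : Plane → ℝ} {W : Fin 2 → Plane → ℝ}

theorem ae_differentiableAt (hc : Convex ℝ Ω) (hv : v ∈ 𝒯.feSpace) :
    ∀ᵐ x ∂(volume.restrict Ω), DifferentiableAt ℝ v x := by
  filter_upwards [𝒯.ae_mem_interior hc] with x ⟨t, ht, hx⟩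
  obtain ⟨l, hl⟩ := hv.2.1 t ht
  exact (hasFDerivAt_of_eqOn hl hx).differentiableAt

theorem memLp_top_partialDeriv (hc : Convex ℝ Ω) (i : Fin 2) (hv : v ∈ 𝒯.feSpace) :
    MemLp (partialDeriv i v) ⊤ (volume.restrict Ω) := by
  choose! l hl using hv.2.1
  refine memLp_top_of_bound (measurable_partialDeriv i v).aestronglyMeasurable
    (∑ t ∈ 𝒯.triangles, |(l t).linear (EuclideanSpace.single i 1)|) ?_
  filter_upwards [𝒯.ae_mem_interior hc] with x ⟨t, ht, hx⟩
  rw [partialDeriv_of_eqOn (hl t ht) hx, Real.norm_eq_abs]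
  exact Finset.single_le_sum (f := fun t => |(l t).linear (EuclideanSpace.single i 1)|)
    (fun _ _ => abs_nonneg _) ht

theorem memLp_top_jac (hc : Convex ℝ Ω) (hW : ∀ i, W i ∈ 𝒯.feSpace) (i j : Fin 2) :
    MemLp (fun x => jac W x i j) ⊤ (volume.restrict Ω) :=
  memLp_top_partialDeriv hc i (hW j)

theorem integrableOn_det_jac (hc : Convex ℝ Ω) (hW : ∀ i, W i ∈ 𝒯.feSpace) :
    IntegrableOn (fun x => (jac W x).det) Ω := by
  have := 𝒯.isFiniteMeasure_restrict
  have hmul (i j k l : Fin 2) : MemLp (fun x => jac W x i j * jac W x k l) ⊤ (volume.restrict Ω) :=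
    (memLp_top_jac hc hW k l).mul (memLp_top_jac hc hW i j) (r := ⊤)
  simp only [Matrix.det_fin_two]
  exact ((hmul 0 0 1 1).sub (hmul 0 1 1 0)).integrable le_top

theorem integral_det_jac (ho : IsOpen Ω) (hc : Convex ℝ Ω) (hW : ∀ i, W i ∈ 𝒯.feSpace)
    (hT : TangentialTraceZero Ω W) : ∫ x in Ω, (jac W x).det = 0 := by
  have htriangle : ∀ t ∈ 𝒯.triangles, ∫ x in convexHull ℝ (t : Set Plane), (jac W x).det =
      refArea / 2 * ∑ a ∈ t, ∑ b ∈ t, valueCross W a b * SignType.sign (orient t a b) := by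
    intro t ht
    choose L hL using fun i => (hW i).2.1 t ht
    exact setIntegral_det_jac_of_eqOn (𝒯.mem_triangles.1 ht).2 hL
  rw [← 𝒯.sum_setIntegral hc (integrableOn_det_jac hc hW), Finset.sum_congr rfl htriangle,
    ← Finset.mul_sum, 𝒯.sum_mul_sign_orient_eq_zero ho hc
      fun a b hab => valueCross_eq_zero_of_segment_subset_frontier hT hab, mul_zero]

end Triangulation

/-! ### Elliptic matrices -/

theorem frob_self_nonneg (D : Matrix (Fin 2) (Fin 2) ℝ) : 0 ≤ frob D D :=
  Finset.sum_nonneg fun _ _ => Finset.sum_nonneg fun _ _ => mul_self_nonneg _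

theorem frob_self_eq_zero {D : Matrix (Fin 2) (Fin 2) ℝ} : frob D D = 0 ↔ D = 0 := by
  simp only [frob, ← Finset.sum_product', ← Matrix.ext_iff, Matrix.zero_apply]
  rw [Finset.sum_eq_zero_iff_of_nonneg fun _ _ => mul_self_nonneg _]
  simp

theorem frob_sq_le (M D : Matrix (Fin 2) (Fin 2) ℝ) :
    frob M D ^ 2 ≤ frob M M * frob D D := by
  simp only [frob, ← Finset.sum_product', ← pow_two]
  exact Finset.sum_mul_sq_le_sq_mul_sq _ _ _

theorem frob_fin_two (M D : Matrix (Fin 2) (Fin 2) ℝ) :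
    frob M D = M 0 0 * D 0 0 + M 0 1 * D 0 1 + M 1 0 * D 1 0 + M 1 1 * D 1 1 := by
  simp only [frob, Fin.sum_univ_two]
  ring

theorem frob_mul_self (M S : Matrix (Fin 2) (Fin 2) ℝ) :
    frob M (S * S) = S.trace * frob M S - M.trace * S.det := by
  simp only [frob_fin_two, Matrix.mul_apply, Fin.sum_univ_two, Matrix.trace_fin_two,
    Matrix.det_fin_two]
  ring

theorem sub_sq_le_two_mul_frob_self (D : Matrix (Fin 2) (Fin 2) ℝ) :
    (D 1 0 - D 0 1) ^ 2 ≤ 2 * frob D D := by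
  rw [frob_fin_two]
  nlinarith [sq_nonneg (D 1 0 + D 0 1), sq_nonneg (D 0 0), sq_nonneg (D 1 1)]

theorem trace_sq_le_two_mul_frob_self (D : Matrix (Fin 2) (Fin 2) ℝ) :
    D.trace ^ 2 ≤ 2 * frob D D := by
  rw [frob_fin_two, Matrix.trace_fin_two]
  nlinarith [sq_nonneg (D 0 0 - D 1 1), sq_nonneg (D 1 0), sq_nonneg (D 0 1)]

theorem frob_add (M D E : Matrix (Fin 2) (Fin 2) ℝ) : frob M (D + E) = frob M D + frob M E := by
  simp only [frob_fin_two, Matrix.add_apply]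
  ring

theorem frob_smul (r : ℝ) (M D : Matrix (Fin 2) (Fin 2) ℝ) : frob M (r • D) = r * frob M D := by
  simp only [frob_fin_two, Matrix.smul_apply, smul_eq_mul]
  ring

/-- The linear functional `D ↦ M : D`, through which the load `(f, A : D G_h v)` depends on `v`. -/
def frobDual (M : Matrix (Fin 2) (Fin 2) ℝ) : Module.Dual ℝ (Matrix (Fin 2) (Fin 2) ℝ) where
  toFun := frob M
  map_add' := frob_add M
  map_smul' r := frob_smul r M

/-- The integrand of `a_{1,h}` at a point where the coefficient is `M`, as a bilinear form in the
two Jacobians; `rot W` is `D 1 0 - D 0 1` for `D = jac W`. -/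
def energyDensity (M : Matrix (Fin 2) (Fin 2) ℝ) :
    LinearMap.BilinForm ℝ (Matrix (Fin 2) (Fin 2) ℝ) :=
  LinearMap.mk₂ ℝ
    (fun D E => frob M D * frob M E + (D 1 0 - D 0 1) * (E 1 0 - E 0 1))
    (fun _ _ _ => by simp only [frob_add, Matrix.add_apply]; ring)
    (fun _ _ _ => by simp only [frob_smul, Matrix.smul_apply, smul_eq_mul]; ring)
    (fun _ _ _ => by simp only [frob_add, Matrix.add_apply]; ring)
    (fun _ _ _ => by simp only [frob_smul, Matrix.smul_apply, smul_eq_mul]; ring)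

theorem energyDensity_apply (M D E : Matrix (Fin 2) (Fin 2) ℝ) :
    energyDensity M D E = frob M D * frob M E + (D 1 0 - D 0 1) * (E 1 0 - E 0 1) := rfl

/-- Symmetric `2 × 2` matrices whose quadratic form lies between `α |ξ|²` and `β |ξ|²`. -/
structure IsEllipticMatrix (α β : ℝ) (M : Matrix (Fin 2) (Fin 2) ℝ) : Prop where
  symm : M.IsSymm
  le_quadForm : ∀ ξ : Fin 2 → ℝ, α * (ξ ⬝ᵥ ξ) ≤ ξ ⬝ᵥ M.mulVec ξ
  quadForm_le : ∀ ξ : Fin 2 → ℝ, ξ ⬝ᵥ M.mulVec ξ ≤ β * (ξ ⬝ᵥ ξ)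

namespace IsEllipticMatrix

variable {α β : ℝ} {M : Matrix (Fin 2) (Fin 2) ℝ} (hM : IsEllipticMatrix α β M)
include hM

theorem apply_one_zero : M 1 0 = M 0 1 := hM.symm.apply 0 1

theorem le_fin_two (x y : ℝ) :
    α * (x ^ 2 + y ^ 2) ≤ M 0 0 * x ^ 2 + 2 * M 0 1 * x * y + M 1 1 * y ^ 2 := by
  have h := hM.le_quadForm ![x, y]
  simp only [dotProduct, Matrix.mulVec, Fin.sum_univ_two, Matrix.cons_val_zero,
    Matrix.cons_val_one, hM.apply_one_zero] at h
  linarith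

theorem fin_two_le (x y : ℝ) :
    M 0 0 * x ^ 2 + 2 * M 0 1 * x * y + M 1 1 * y ^ 2 ≤ β * (x ^ 2 + y ^ 2) := by
  have h := hM.quadForm_le ![x, y]
  simp only [dotProduct, Matrix.mulVec, Fin.sum_univ_two, Matrix.cons_val_zero,
    Matrix.cons_val_one, hM.apply_one_zero] at h
  linarith

theorem two_mul_le_trace : 2 * α ≤ M.trace := by
  rw [Matrix.trace_fin_two]
  linarith [hM.le_fin_two 1 0, hM.le_fin_two 0 1]

theorem trace_le_two_mul : M.trace ≤ 2 * β := by
  rw [Matrix.trace_fin_two]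
  linarith [hM.fin_two_le 1 0, hM.fin_two_le 0 1]

theorem frob_self_le (hα : 0 < α) : frob M M ≤ 4 * β ^ 2 := by
  have ha : 0 ≤ M 0 0 := by linarith [hM.le_fin_two 1 0]
  have hd : 0 ≤ M 1 1 := by linarith [hM.le_fin_two 0 1]
  have hb : |M 0 1| ≤ β - (M 0 0 + M 1 1) / 2 :=
    abs_le.2 ⟨by linarith [hM.fin_two_le 1 (-1)], by linarith [hM.fin_two_le 1 1]⟩
  rw [frob_fin_two, hM.apply_one_zero, ← abs_mul_abs_self (M 0 1)]
  nlinarith [abs_nonneg (M 0 1), mul_nonneg ha hd]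

theorem mul_frob_self_le_frob_mul_self {S : Matrix (Fin 2) (Fin 2) ℝ} (hS : S.IsSymm) :
    α * frob S S ≤ frob M (S * S) := by
  have hS10 : S 1 0 = S 0 1 := hS.apply 0 1
  simp only [frob_fin_two, Matrix.mul_apply, Fin.sum_univ_two, hM.apply_one_zero, hS10]
  linarith [hM.le_fin_two (S 0 0) (S 0 1), hM.le_fin_two (S 0 1) (S 1 1)]

/-- Cayley–Hamilton for the symmetric part `S` of `D` gives `M : S² = tr S (M : S) - tr M det S`,
and `M : S² ≥ α |S|²`. -/
theorem mul_frob_self_add_trace_mul_det_le (D : Matrix (Fin 2) (Fin 2) ℝ) :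
    α * frob D D + M.trace * D.det ≤ D.trace * frob M D + β * (D 1 0 - D 0 1) ^ 2 := by
  have hS : ((2⁻¹ : ℝ) • (D + D.transpose)).IsSymm :=
    (Matrix.isSymm_add_transpose_self D).smul _
  have h := hM.mul_frob_self_le_frob_mul_self hS
  rw [frob_mul_self] at h
  simp only [frob_fin_two, Matrix.trace_fin_two, Matrix.det_fin_two, Matrix.smul_apply,
    Matrix.add_apply, Matrix.transpose_apply, smul_eq_mul, hM.apply_one_zero] at h ⊢
  have htr : (M 0 0 + M 1 1) / 4 + α / 2 ≤ β := by
    linarith [hM.two_mul_le_trace, hM.trace_le_two_mul, M.trace_fin_two]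
  nlinarith [mul_le_mul_of_nonneg_right htr (sq_nonneg (D 1 0 - D 0 1))]

/-- After multiplication by `α`, Young's inequality absorbs `tr D (M : D)` into `|D|²`; as
`tr M ∈ [2α, 2β]`, multiplying by `4αβ / tr M` makes the coefficient of `det D` independent
of `M`. -/
theorem cube_mul_frob_self_add_mul_det_le (hα : 0 < α) (D : Matrix (Fin 2) (Fin 2) ℝ) :
    α ^ 3 * frob D D + 4 * α ^ 2 * β * D.det ≤ 2 * β * (1 + α * β) * energyDensity M D D := by
  have hτ := hM.two_mul_le_trace
  have hτβ := hM.trace_le_two_mul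
  have hτ0 : 0 < M.trace := by linarith
  have hβ : 0 < β := by linarith
  set R := energyDensity M D D
  have hR : R = frob M D ^ 2 + (D 1 0 - D 0 1) ^ 2 := by
    simp only [R, energyDensity_apply, pow_two]
  have hR0 : 0 ≤ R := by rw [hR]; positivity
  have young : α ^ 2 * frob D D + 2 * α * M.trace * D.det ≤ 2 * ((1 + α * β) * R) := by
    have h := mul_le_mul_of_nonneg_left (hM.mul_frob_self_add_trace_mul_det_le D) hα.le
    rw [hR]
    linarith [sq_nonneg (α * D.trace - 2 * frob M D), sq_nonneg (D 1 0 - D 0 1),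
      mul_nonneg (mul_nonneg hα.le hβ.le) (sq_nonneg (frob M D)),
      mul_le_mul_of_nonneg_left (trace_sq_le_two_mul_frob_self D) (sq_nonneg α)]
  refine le_of_mul_le_mul_left ?_ hτ0
  calc M.trace * (α ^ 3 * frob D D + 4 * α ^ 2 * β * D.det)
      ≤ 2 * α * β * (α ^ 2 * frob D D + 2 * α * M.trace * D.det) := by
        linarith [mul_le_mul_of_nonneg_right hτβ
          (mul_nonneg (pow_nonneg hα.le 3) (frob_self_nonneg D))]
    _ ≤ 2 * α * β * (2 * ((1 + α * β) * R)) := by gcongr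
    _ ≤ M.trace * β * (2 * ((1 + α * β) * R)) := by gcongr
    _ = M.trace * (2 * β * (1 + α * β) * R) := by ring

theorem energyDensity_self_le (hα : 0 < α) (D : Matrix (Fin 2) (Fin 2) ℝ) :
    energyDensity M D D ≤ (4 * β ^ 2 + 2) * frob D D := by
  rw [energyDensity_apply, ← pow_two, ← pow_two, add_mul]
  exact add_le_add ((frob_sq_le M D).trans
    (mul_le_mul_of_nonneg_right (hM.frob_self_le hα) (frob_self_nonneg D)))
    (sub_sq_le_two_mul_frob_self D)

end IsEllipticMatrix

/-! ### Fields with vanishing Jacobian -/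

namespace Triangulation

variable {Ω : Set Plane} {𝒯 : Triangulation Ω}

theorem eq_of_mem_convexHull_of_ae_partialDeriv_eq_zero (ho : IsOpen Ω) {v : Plane → ℝ}
    (hv : v ∈ 𝒯.feSpace) (h : ∀ᵐ x ∂(volume.restrict Ω), ∀ i, partialDeriv i v x = 0)
    {t : Finset Plane} (ht : t ∈ 𝒯.triangles) {x y : Plane}
    (hx : x ∈ convexHull ℝ (t : Set Plane)) (hy : y ∈ convexHull ℝ (t : Set Plane)) :
    v x = v y := by
  obtain ⟨l, hl⟩ := hv.2.1 t ht
  have hinter : (interior (convexHull ℝ (t : Set Plane)) ∩ Ω).Nonempty := by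
    obtain ⟨z, hz⟩ := 𝒯.interior_convexHull_nonempty ht
    exact _root_.mem_closure_iff.1 (𝒯.convexHull_subset_closure ht (interior_subset hz)) _
      isOpen_interior hz
  obtain ⟨z, hz, hvz⟩ : ∃ z ∈ interior (convexHull ℝ (t : Set Plane)) ∩ Ω,
      ∀ i, partialDeriv i v z = 0 :=
    (frequently_ae_mem_iff.2 ((isOpen_interior.inter ho).measure_pos volume hinter).ne')
      |>.and_eventually ((ae_restrict_iff' ho.measurableSet).1 h)
      |>.exists.imp fun z hz => ⟨hz.1, hz.2 hz.1.2⟩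
  have hlinear : l.linear = 0 := (EuclideanSpace.basisFun (Fin 2) ℝ).toBasis.ext fun i => by
    simpa [hvz i] using (partialDeriv_of_eqOn hl hz.1 i).symm
  have hsub : l x - l y = l.linear (x - y) := (l.linearMap_vsub x y).symm
  rw [hl hx, hl hy, ← sub_eq_zero, hsub, hlinear, LinearMap.zero_apply]

theorem exists_eqOn_const_of_ae_partialDeriv_eq_zero (ho : IsOpen Ω) (hc : Convex ℝ Ω)
    {v : Plane → ℝ} (hv : v ∈ 𝒯.feSpace)
    (h : ∀ᵐ x ∂(volume.restrict Ω), ∀ i, partialDeriv i v x = 0) :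
    ∃ k, ∀ x ∈ closure Ω, v x = k := by
  have hfinite : (v '' closure Ω).Finite := by
    refine (𝒯.nodes.finite_toSet.image v).subset ?_
    rintro _ ⟨x, hx, rfl⟩
    obtain ⟨t, ht, hxt⟩ := 𝒯.mem_closure_iff.1 hx
    obtain ⟨a, ha⟩ : t.Nonempty := Finset.card_pos.1 (by simp [(𝒯.mem_triangles.1 ht).2])
    exact ⟨a, 𝒯.mem_nodes_of_mem ht ha, eq_of_mem_convexHull_of_ae_partialDeriv_eq_zero ho hv h ht
      (subset_convexHull ℝ _ ha) hxt⟩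
  have hsub : (v '' closure Ω).Subsingleton :=
    hfinite.countable.isTotallyDisconnected _ subset_rfl (hc.closure.isPreconnected.image v hv.1)
  rcases (v '' closure Ω).eq_empty_or_nonempty with hempty | ⟨k, hk⟩
  · exact ⟨0, fun x hx => absurd ⟨x, hx, rfl⟩ (hempty ▸ Set.notMem_empty (v x))⟩
  · exact ⟨k, fun x hx => hsub ⟨x, hx, rfl⟩ hk⟩

/-- Following a level line to the boundary and then a boundary segment to a vertex, `f` takes only
finitely many values on `Ω`, whereas a nonzero functional is open. -/
theorem eq_zero_of_eq_on_frontier_segments (𝒯 : Triangulation Ω) (ho : IsOpen Ω)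
    (hc : Convex ℝ Ω) (hne : Ω.Nonempty) {f : Plane →L[ℝ] ℝ}
    (hf : ∀ p q, segment ℝ p q ⊆ frontier Ω → f p = f q) : f = 0 := by
  by_contra hf0
  obtain ⟨d, hd, hd0⟩ := (Submodule.ne_bot_iff _).1
    (LinearMap.ker_ne_bot_of_finrank_lt (f := f.toLinearMap) (by simp))
  have hfd : f d = 0 := hd
  have himage : f '' Ω ⊆ f '' 𝒯.nodes := by
    rintro _ ⟨y, hy, rfl⟩
    obtain ⟨r, hr⟩ :=
      exists_add_smul_mem_frontier (𝒯.isCompact_closure.isBounded.subset subset_closure) hy hd0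
    obtain ⟨t, ht, hxt⟩ := 𝒯.mem_closure_iff.1 (frontier_subset_closure hr)
    rw [ho.frontier_eq] at hr
    obtain ⟨a, ha, hax⟩ := exists_segment_subset_frontier ho hc
      (fun a ha => 𝒯.mem_closure_of_mem ht ha) hxt hr.2
    refine ⟨a, 𝒯.mem_nodes_of_mem ht ha, ?_⟩
    rw [hf _ _ hax, map_add, map_smul, hfd, smul_zero, add_zero]
  obtain ⟨z, hz⟩ := hne
  exact infinite_of_mem_nhds (f z)
    ((f.isOpenMap_of_ne_zero hf0 Ω ho).mem_nhds (Set.mem_image_of_mem f hz))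
    ((𝒯.nodes.finite_toSet.image f).subset himage)

theorem eq_zero_of_ae_jac_eq_zero (ho : IsOpen Ω) (hc : Convex ℝ Ω) {W : Fin 2 → Plane → ℝ}
    (hW : ∀ i, W i ∈ 𝒯.feSpace) (hT : TangentialTraceZero Ω W)
    (h : ∀ᵐ x ∂(volume.restrict Ω), jac W x = 0) : W = 0 := by
  have hconst (j : Fin 2) : ∃ k, ∀ x ∈ closure Ω, W j x = k :=
    exists_eqOn_const_of_ae_partialDeriv_eq_zero ho hc (hW j) <| by
      filter_upwards [h] with x hx i using congrFun (congrFun hx i) j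
  choose k hk using hconst
  let f : Plane →L[ℝ] ℝ := ∑ i, k i • EuclideanSpace.proj i
  have hf (p : Plane) : f p = ∑ i, k i * p i := by simp [f]
  ext j x
  by_cases hx : x ∈ closure Ω
  · have hf0 : f = 0 := by
      refine 𝒯.eq_zero_of_eq_on_frontier_segments ho hc (closure_nonempty_iff.1 ⟨x, hx⟩) ?_
      intro p q hpq
      have htrace := hT p q hpq p (left_mem_segment ℝ p q)
      have hp := frontier_subset_closure (hpq (left_mem_segment ℝ p q))
      simp only [hk _ p hp, mul_sub, Finset.sum_sub_distrib] at htrace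
      rw [hf, hf]
      linarith
    have hkj : k j = f (EuclideanSpace.single j 1) := by simp [hf]
    rw [hk j x hx, hkj, hf0]
    rfl
  · exact (hW j).2.2 x hx

end Triangulation

/-! ### The energy of finite element fields -/

/-- Measurable, symmetric and uniformly elliptic coefficients on `Ω`, for which the energy is
coercive in two dimensions. -/
structure IsEllipticCoefficient (Ω : Set Plane) (α β : ℝ)
    (A : Plane → Matrix (Fin 2) (Fin 2) ℝ) : Prop where
  aemeasurable : ∀ i j, AEMeasurable (fun x => A x i j) (volume.restrict Ω)
  elliptic : ∀ x ∈ Ω, IsEllipticMatrix α β (A x)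

theorem IsCordesCoefficient.isEllipticCoefficient {Ω : Set Plane} {α β ε : ℝ}
    {A : Plane → Matrix (Fin 2) (Fin 2) ℝ} (hA : IsCordesCoefficient Ω α β ε A) :
    IsEllipticCoefficient Ω α β A where
  aemeasurable := hA.aemeasurable
  elliptic x hx := ⟨hA.symm x hx, fun ξ => (hA.elliptic x hx ξ).1, fun ξ => (hA.elliptic x hx ξ).2⟩

section MatrixFields

variable {X : Type*} [MeasurableSpace X] {μ : Measure X} {A D E : X → Matrix (Fin 2) (Fin 2) ℝ}

theorem memLp_top_frob (hA : ∀ i j, MemLp (fun x => A x i j) ⊤ μ)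
    (hD : ∀ i j, MemLp (fun x => D x i j) ⊤ μ) : MemLp (fun x => frob (A x) (D x)) ⊤ μ :=
  memLp_finsetSum _ fun i _ => memLp_finsetSum _ fun j _ => (hD i j).mul (hA i j)

theorem memLp_top_energyDensity (hA : ∀ i j, MemLp (fun x => A x i j) ⊤ μ)
    (hD : ∀ i j, MemLp (fun x => D x i j) ⊤ μ) (hE : ∀ i j, MemLp (fun x => E x i j) ⊤ μ) :
    MemLp (fun x => energyDensity (A x) (D x) (E x)) ⊤ μ :=
  ((memLp_top_frob hA hE).mul (memLp_top_frob hA hD)).add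
    (((hE 1 0).sub (hE 0 1)).mul ((hD 1 0).sub (hD 0 1)))

end MatrixFields

section FieldEnergy

variable {Ω : Set Plane} {𝒯 : Triangulation Ω} {α β : ℝ} {A : Plane → Matrix (Fin 2) (Fin 2) ℝ}
  {V W : Fin 2 → Plane → ℝ}

theorem IsEllipticCoefficient.memLp_top (hA : IsEllipticCoefficient Ω α β A) (hα : 0 < α)
    (ho : IsOpen Ω) (i j : Fin 2) : MemLp (fun x => A x i j) ⊤ (volume.restrict Ω) := by
  refine memLp_top_of_bound (hA.aemeasurable i j).aestronglyMeasurable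
    (Real.sqrt (4 * β ^ 2)) ?_
  filter_upwards [ae_restrict_mem ho.measurableSet] with x hx
  refine Real.abs_le_sqrt (le_trans ?_ ((hA.elliptic x hx).frob_self_le hα))
  simp only [frob, ← Finset.sum_product', ← pow_two]
  exact Finset.single_le_sum (f := fun p : Fin 2 × Fin 2 => A x p.1 p.2 ^ 2)
    (fun _ _ => sq_nonneg _) (Finset.mem_univ (i, j))

namespace Triangulation

theorem ae_jac_add (hc : Convex ℝ Ω) (hV : ∀ i, V i ∈ 𝒯.feSpace) (hW : ∀ i, W i ∈ 𝒯.feSpace) :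
    ∀ᵐ x ∂(volume.restrict Ω), jac (V + W) x = jac V x + jac W x := by
  filter_upwards [ae_all_iff.2 fun i => ae_differentiableAt hc (hV i),
    ae_all_iff.2 fun i => ae_differentiableAt hc (hW i)] with x hVx hWx
  ext i j
  simp [jac, partialDeriv, fderiv_add (hVx j) (hWx j)]

theorem ae_jac_smul (hc : Convex ℝ Ω) (r : ℝ) (hW : ∀ i, W i ∈ 𝒯.feSpace) :
    ∀ᵐ x ∂(volume.restrict Ω), jac (r • W) x = r • jac W x := by
  filter_upwards [ae_all_iff.2 fun i => ae_differentiableAt hc (hW i)] with x hWx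
  ext i j
  simp [jac, partialDeriv, fderiv_const_smul (hWx j)]

theorem integrableOn_apply_jac (hc : Convex ℝ Ω)
    {φ : Plane → Module.Dual ℝ (Matrix (Fin 2) (Fin 2) ℝ)}
    (hφ : ∀ i j, IntegrableOn (fun x => φ x (Matrix.single i j 1)) Ω)
    (hW : ∀ i, W i ∈ 𝒯.feSpace) : IntegrableOn (fun x => φ x (jac W x)) Ω := by
  have hexpand (x : Plane) :
      φ x (jac W x) = ∑ i, ∑ j, jac W x i j * φ x (Matrix.single i j 1) := by
    conv_lhs => rw [Matrix.matrix_eq_sum_single (jac W x)]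
    simp only [map_sum, ← smul_eq_mul, ← map_smul, Matrix.smul_single]
    simp only [smul_eq_mul, mul_one]
  simp only [hexpand]
  exact integrable_finsetSum _ fun i _ => integrable_finsetSum _ fun j _ =>
    (hφ i j).mul_of_top_right (memLp_top_jac hc hW i j)

theorem isLinearMap_integral_apply_jac (hc : Convex ℝ Ω)
    {φ : Plane → Module.Dual ℝ (Matrix (Fin 2) (Fin 2) ℝ)}
    (hφ : ∀ i j, IntegrableOn (fun x => φ x (Matrix.single i j 1)) Ω)
    {V : Type*} [AddCommGroup V] [Module ℝ V] (G : V →ₗ[ℝ] Fin 2 → Plane → ℝ)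
    (hG : ∀ v i, G v i ∈ 𝒯.feSpace) :
    IsLinearMap ℝ fun v => ∫ x in Ω, φ x (jac (G v) x) where
  map_add v w := by
    rw [← integral_add (integrableOn_apply_jac hc hφ (hG v)) (integrableOn_apply_jac hc hφ (hG w))]
    refine integral_congr_ae ?_
    filter_upwards [ae_jac_add hc (hG v) (hG w)] with x hx
    rw [map_add, hx, map_add]
  map_smul r v := by
    rw [← integral_smul]
    refine integral_congr_ae ?_
    filter_upwards [ae_jac_smul hc r (hG v)] with x hx
    rw [map_smul, hx, map_smul]

theorem integrableOn_energyDensity (ho : IsOpen Ω) (hc : Convex ℝ Ω) (hα : 0 < α)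
    (hA : IsEllipticCoefficient Ω α β A) (hV : ∀ i, V i ∈ 𝒯.feSpace)
    (hW : ∀ i, W i ∈ 𝒯.feSpace) :
    IntegrableOn (fun x => energyDensity (A x) (jac V x) (jac W x)) Ω := by
  have := 𝒯.isFiniteMeasure_restrict
  exact (memLp_top_energyDensity (hA.memLp_top hα ho) (memLp_top_jac hc hV)
    (memLp_top_jac hc hW)).integrable le_top

theorem integrableOn_frob_jac (hc : Convex ℝ Ω) (hW : ∀ i, W i ∈ 𝒯.feSpace) :
    IntegrableOn (fun x => frob (jac W x) (jac W x)) Ω := by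
  have := 𝒯.isFiniteMeasure_restrict
  exact (memLp_top_frob (memLp_top_jac hc hW) (memLp_top_jac hc hW)).integrable le_top

theorem cube_mul_integral_frob_jac_le (ho : IsOpen Ω) (hc : Convex ℝ Ω) (hα : 0 < α)
    (hA : IsEllipticCoefficient Ω α β A) (hW : ∀ i, W i ∈ 𝒯.feSpace)
    (hT : TangentialTraceZero Ω W) :
    α ^ 3 * ∫ x in Ω, frob (jac W x) (jac W x) ≤
      2 * β * (1 + α * β) * ∫ x in Ω, energyDensity (A x) (jac W x) (jac W x) := by
  have hfrob := (integrableOn_frob_jac hc hW).const_mul (α ^ 3)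
  have hdet := (integrableOn_det_jac hc hW).const_mul (4 * α ^ 2 * β)
  calc α ^ 3 * ∫ x in Ω, frob (jac W x) (jac W x)
      = ∫ x in Ω, (α ^ 3 * frob (jac W x) (jac W x) + 4 * α ^ 2 * β * (jac W x).det) := by
        rw [integral_add hfrob hdet, integral_const_mul, integral_const_mul,
          integral_det_jac ho hc hW hT, mul_zero, add_zero]
    _ ≤ ∫ x in Ω, 2 * β * (1 + α * β) * energyDensity (A x) (jac W x) (jac W x) :=
        setIntegral_mono_on (hfrob.fun_add hdet)
          ((integrableOn_energyDensity ho hc hα hA hW hW).const_mul _) ho.measurableSet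
          fun x hx => (hA.elliptic x hx).cube_mul_frob_self_add_mul_det_le hα _
    _ = _ := integral_const_mul _ _

theorem integral_energyDensity_le (ho : IsOpen Ω) (hc : Convex ℝ Ω) (hα : 0 < α)
    (hA : IsEllipticCoefficient Ω α β A) (hW : ∀ i, W i ∈ 𝒯.feSpace) :
    ∫ x in Ω, energyDensity (A x) (jac W x) (jac W x) ≤
      (4 * β ^ 2 + 2) * ∫ x in Ω, frob (jac W x) (jac W x) := by
  rw [← integral_const_mul]
  exact setIntegral_mono_on (integrableOn_energyDensity ho hc hα hA hW hW)
    ((integrableOn_frob_jac hc hW).const_mul _) ho.measurableSet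
    fun x hx => (hA.elliptic x hx).energyDensity_self_le hα _

theorem eq_zero_of_integral_energyDensity_eq_zero (ho : IsOpen Ω) (hc : Convex ℝ Ω) (hα : 0 < α)
    (hA : IsEllipticCoefficient Ω α β A) (hW : ∀ i, W i ∈ 𝒯.feSpace)
    (hT : TangentialTraceZero Ω W)
    (h : ∫ x in Ω, energyDensity (A x) (jac W x) (jac W x) = 0) : W = 0 := by
  have hle := cube_mul_integral_frob_jac_le ho hc hα hA hW hT
  rw [h, mul_zero] at hle
  have hzero : ∫ x in Ω, frob (jac W x) (jac W x) = 0 :=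
    le_antisymm (nonpos_of_mul_nonpos_right hle (pow_pos hα 3))
      (integral_nonneg fun x => frob_self_nonneg _)
  rw [integral_eq_zero_iff_of_nonneg (fun x => frob_self_nonneg _)
    (integrableOn_frob_jac hc hW)] at hzero
  refine eq_zero_of_ae_jac_eq_zero ho hc hW hT ?_
  filter_upwards [hzero] with x hx using frob_self_eq_zero.1 hx

end Triangulation

end FieldEnergy

/-! ### The recovery operator and the scheme -/

theorem existsUnique_apply_eq_of_definite {K V : Type*} [Field K] [AddCommGroup V] [Module K V]
    [FiniteDimensional K V] (B : LinearMap.BilinForm K V) (hB : ∀ v, B v v = 0 → v = 0)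
    (φ : Module.Dual K V) : ∃! u, ∀ v, B u v = φ v := by
  have hinj : Function.Injective B := (injective_iff_map_eq_zero B).2 fun v hv =>
    hB v (by rw [hv, LinearMap.zero_apply])
  have hsurj : Function.Surjective B :=
    (LinearMap.injective_iff_surjective_of_finrank_eq_finrank
      (Subspace.dual_finrank_eq (K := K) (V := V)).symm).1 hinj
  obtain ⟨u, hu⟩ := hsurj φ
  exact ⟨u, fun v => LinearMap.congr_fun hu v,
    fun w hw => hinj ((LinearMap.ext hw).trans hu.symm)⟩

section Scheme

variable {Ω : Set Plane} {𝒯 : Triangulation Ω} {α β : ℝ} {A : Plane → Matrix (Fin 2) (Fin 2) ℝ}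
  {v w : Plane → ℝ}

theorem Triangulation.eq_zero_of_norm0_eq_zero (ho : IsOpen Ω) (hv : v ∈ 𝒯.feSpaceZero)
    (h : norm0 Ω (fun _ : Unit => v) = 0) : v = 0 := by
  have hsq : ContinuousOn (fun x => v x ^ 2) (closure Ω) := hv.1.1.pow 2
  have hint : IntegrableOn (fun x => v x ^ 2) Ω :=
    (hsq.integrableOn_compact 𝒯.isCompact_closure).mono_set subset_closure
  have hnonneg : 0 ≤ ∫ x in Ω, v x ^ 2 := integral_nonneg fun _ => sq_nonneg _
  have hzero : ∫ x in Ω, v x ^ 2 = 0 := by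
    simpa [norm0, Real.sqrt_eq_zero hnonneg] using h
  rw [integral_eq_zero_iff_of_nonneg (fun _ => sq_nonneg _) hint] at hzero
  have hΩ : Set.EqOn v 0 Ω := by
    refine Measure.eqOn_open_of_ae_eq (μ := volume) ?_ ho (hv.1.1.mono subset_closure)
      continuousOn_const
    filter_upwards [hzero] with x hx using pow_eq_zero_iff two_ne_zero |>.1 hx
  ext x
  by_cases hx : x ∈ closure Ω
  · exact (Set.EqOn.of_subset_closure hΩ hv.1.1 continuousOn_const subset_closure subset_rfl) hx
  · exact hv.1.2.2 x hx

namespace Sampling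

variable (S : Sampling 𝒯)

theorem isQuadraticFit_fit (v : Plane → ℝ) (z : 𝒯.nodes) :
    IsQuadraticFit (S.pts z) v (S.fit v z) :=
  (existsUnique_quadraticFit (S.unisolvent z) v).choose_spec.1

theorem fit_add (v w : Plane → ℝ) (z : 𝒯.nodes) : S.fit (v + w) z = S.fit v z + S.fit w z := by
  have hv := S.isQuadraticFit_fit v z
  have hw := S.isQuadraticFit_fit w z
  refine (existsUnique_quadraticFit (S.unisolvent z) (v + w)).unique (S.isQuadraticFit_fit _ z)
    ⟨add_mem hv.1 hw.1, fun q hq => ?_⟩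
  calc ∑ x ∈ S.pts z, (polyVal (S.fit v z + S.fit w z) x - (v + w) x) * polyVal q x
      = ∑ x ∈ S.pts z, ((polyVal (S.fit v z) x - v x) * polyVal q x +
          (polyVal (S.fit w z) x - w x) * polyVal q x) :=
        Finset.sum_congr rfl fun x _ => by simp only [polyVal, map_add, Pi.add_apply]; ring
    _ = 0 := by rw [Finset.sum_add_distrib, hv.2 q hq, hw.2 q hq, add_zero]

theorem fit_smul (r : ℝ) (v : Plane → ℝ) (z : 𝒯.nodes) : S.fit (r • v) z = r • S.fit v z := by
  have hv := S.isQuadraticFit_fit v z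
  refine (existsUnique_quadraticFit (S.unisolvent z) (r • v)).unique (S.isQuadraticFit_fit _ z)
    ⟨Submodule.smul_mem _ r hv.1, fun q hq => ?_⟩
  calc ∑ x ∈ S.pts z, (polyVal (r • S.fit v z) x - (r • v) x) * polyVal q x
      = ∑ x ∈ S.pts z, r * ((polyVal (S.fit v z) x - v x) * polyVal q x) :=
        Finset.sum_congr rfl fun x _ => by
          simp only [polyVal, MvPolynomial.smul_eval, Pi.smul_apply, smul_eq_mul]; ring
    _ = 0 := by rw [← Finset.mul_sum, hv.2 q hq, mul_zero]

/-- The recovery operator `G_h` as a linear map. -/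
def gradMap : (Plane → ℝ) →ₗ[ℝ] Fin 2 → Plane → ℝ where
  toFun := S.grad
  map_add' v w := by
    ext i x
    simp only [grad, fit_add, map_add, polyVal, Pi.add_apply, add_mul, Finset.sum_add_distrib]
  map_smul' r v := by
    ext i x
    simp only [grad, fit_smul, Derivation.map_smul, polyVal, MvPolynomial.smul_eval,
      Pi.smul_apply, smul_eq_mul, Finset.mul_sum, mul_assoc, RingHom.id_apply]

theorem grad_mem_feSpace (v : Plane → ℝ) (i : Fin 2) : S.grad v i ∈ 𝒯.feSpace := by
  have hsum : S.grad v i = ∑ z : 𝒯.nodes,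
      polyVal (MvPolynomial.pderiv i (S.fit v z)) z • 𝒯.shape z := by
    ext x
    simp [grad]
  rw [hsum]
  exact 𝒯.feSubmodule.sum_mem fun z _ => 𝒯.feSubmodule.smul_mem _ (𝒯.shape_mem_feSpace z)

/-- The space `V_h^{0,0}` as a linear subspace of the functions on the plane, on which the scheme is
posed. -/
def zeroZero : Submodule ℝ (Plane → ℝ) where
  carrier := S.spaceZeroZero
  zero_mem' := by
    refine ⟨⟨𝒯.feSubmodule.zero_mem, fun _ _ => rfl⟩, fun p q _ x _ => ?_⟩
    rw [show S.grad 0 = 0 from S.gradMap.map_zero]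
    simp
  add_mem' {v w} hv hw := by
    refine ⟨⟨𝒯.feSubmodule.add_mem hv.1.1 hw.1.1, fun x hx => ?_⟩, fun p q hpq x hx => ?_⟩
    · simp [hv.1.2 x hx, hw.1.2 x hx]
    · rw [show S.grad (v + w) = S.grad v + S.grad w from S.gradMap.map_add v w]
      simp only [Pi.add_apply, add_mul, Finset.sum_add_distrib, hv.2 p q hpq x hx,
        hw.2 p q hpq x hx, add_zero]
  smul_mem' r v hv := by
    refine ⟨⟨𝒯.feSubmodule.smul_mem r hv.1.1, fun x hx => by simp [hv.1.2 x hx]⟩,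
      fun p q hpq x hx => ?_⟩
    rw [show S.grad (r • v) = r • S.grad v from S.gradMap.map_smul r v]
    simp only [Pi.smul_apply, smul_eq_mul, mul_assoc, ← Finset.mul_sum, hv.2 p q hpq x hx,
      mul_zero]

instance finiteDimensional_zeroZero : FiniteDimensional ℝ S.zeroZero := by
  let nodalValues : S.zeroZero →ₗ[ℝ] 𝒯.nodes → ℝ :=
    LinearMap.funLeft ℝ ℝ ((↑) : 𝒯.nodes → Plane) ∘ₗ S.zeroZero.subtype
  refine FiniteDimensional.of_injective nodalValues ((injective_iff_map_eq_zero _).2 fun v hv => ?_)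
  exact Subtype.ext (Triangulation.eq_zero_of_nodes v.2.1.1 fun z hz => congrFun hv ⟨z, hz⟩)

variable {S}

theorem DiscretePoincare.eq_zero_of_grad_eq_zero (hS : S.DiscretePoincare) (ho : IsOpen Ω)
    (hv : v ∈ 𝒯.feSpaceZero) (h : S.grad v = 0) : v = 0 := by
  obtain ⟨C, hC⟩ := hS
  refine Triangulation.eq_zero_of_norm0_eq_zero ho hv
    (le_antisymm ((hC v hv).1.trans_eq ?_) (Real.sqrt_nonneg _))
  simp [h, norm0]

variable (S)

theorem form_eq_integral (ho : IsOpen Ω) (hc : Convex ℝ Ω) (hα : 0 < α)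
    (hA : IsEllipticCoefficient Ω α β A) (v w : Plane → ℝ) :
    S.form A v w = ∫ x in Ω, energyDensity (A x) (jac (S.grad v) x) (jac (S.grad w) x) :=
  𝒯.sum_setIntegral hc (Triangulation.integrableOn_energyDensity ho hc hα hA
    (S.grad_mem_feSpace v) (S.grad_mem_feSpace w))

theorem form_comm (v w : Plane → ℝ) : S.form A v w = S.form A w v := by
  simp only [form, mul_comm]

theorem isLinearMap_form (ho : IsOpen Ω) (hc : Convex ℝ Ω) (hα : 0 < α)
    (hA : IsEllipticCoefficient Ω α β A) (v : Plane → ℝ) : IsLinearMap ℝ (S.form A v) := by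
  have := 𝒯.isFiniteMeasure_restrict
  have hcoeff (i j : Fin 2) : IntegrableOn
      (fun x => energyDensity (A x) (jac (S.grad v) x) (Matrix.single i j 1)) Ω :=
    (memLp_top_energyDensity (E := fun _ => Matrix.single i j 1) (hA.memLp_top hα ho)
      (Triangulation.memLp_top_jac hc (S.grad_mem_feSpace v))
      fun _ _ => memLp_top_const _).integrable le_top
  rw [funext (S.form_eq_integral ho hc hα hA v)]
  exact Triangulation.isLinearMap_integral_apply_jac hc hcoeff S.gradMap S.grad_mem_feSpace

theorem isLinearMap_load (ho : IsOpen Ω) (hc : Convex ℝ Ω) (hα : 0 < α)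
    (hA : IsEllipticCoefficient Ω α β A) {f : Plane → ℝ} (hf : IntegrableOn f Ω) :
    IsLinearMap ℝ fun v => ∫ x in Ω, f x * frob (A x) (jac (S.grad v) x) :=
  Triangulation.isLinearMap_integral_apply_jac (φ := fun x => f x • frobDual (A x)) hc
    (fun _ _ => hf.mul_of_top_left (memLp_top_frob (hA.memLp_top hα ho)
      fun _ _ => memLp_top_const _)) S.gradMap S.grad_mem_feSpace

theorem existsUnique_isSolution (ho : IsOpen Ω) (hc : Convex ℝ Ω) (hα : 0 < α)
    (hA : IsEllipticCoefficient Ω α β A) (hS : ∀ v ∈ S.spaceZeroZero, S.grad v = 0 → v = 0)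
    {f : Plane → ℝ} (hf : IntegrableOn f Ω) : ∃! u, S.IsSolution A f u := by
  have hform := S.isLinearMap_form ho hc hα hA
  let B : LinearMap.BilinForm ℝ (Plane → ℝ) := LinearMap.mk₂ ℝ (S.form A)
    (fun u v w => by simpa only [S.form_comm] using (hform w).map_add u v)
    (fun r u w => by simpa only [S.form_comm] using (hform w).map_smul r u)
    (fun u => (hform u).map_add) (fun r u => (hform u).map_smul r)
  let F : Module.Dual ℝ (Plane → ℝ) := (S.isLinearMap_load ho hc hα hA hf).mk' _
  have hdefinite (v : S.zeroZero) (hv : B.restrict S.zeroZero v v = 0) : v = 0 :=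
    Subtype.ext <| hS v v.2 <| Triangulation.eq_zero_of_integral_energyDensity_eq_zero ho hc hα hA
      (S.grad_mem_feSpace v) v.2.2 ((S.form_eq_integral ho hc hα hA v v).symm.trans hv)
  obtain ⟨u, hu, huniq⟩ :=
    existsUnique_apply_eq_of_definite (B.restrict S.zeroZero) hdefinite (F.domRestrict S.zeroZero)
  exact ⟨u, ⟨u.2, fun v hv => hu ⟨v, hv⟩⟩,
    fun w hw => congrArg Subtype.val (huniq ⟨w, hw.1⟩ fun v => hw.2 v v.2)⟩

theorem mul_normJac_le_energy (ho : IsOpen Ω) (hc : Convex ℝ Ω) (hα : 0 < α) (hβ : 0 < β)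
    (hA : IsEllipticCoefficient Ω α β A) (hv : v ∈ S.spaceZeroZero) :
    Real.sqrt (α ^ 3 / (2 * β * (1 + α * β))) * normJac Ω (S.grad v) ≤ S.energy A v := by
  rw [normJac, energy, ← Real.sqrt_mul (by positivity), div_mul_eq_mul_div]
  refine Real.sqrt_le_sqrt ((div_le_iff₀' (by positivity)).2 ?_)
  rw [S.form_eq_integral ho hc hα hA]
  exact Triangulation.cube_mul_integral_frob_jac_le ho hc hα hA (S.grad_mem_feSpace v) hv.2

theorem energy_le_mul_normJac (ho : IsOpen Ω) (hc : Convex ℝ Ω) (hα : 0 < α)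
    (hA : IsEllipticCoefficient Ω α β A) (v : Plane → ℝ) :
    S.energy A v ≤ Real.sqrt (4 * β ^ 2 + 2) * normJac Ω (S.grad v) := by
  rw [normJac, energy, ← Real.sqrt_mul (by positivity), S.form_eq_integral ho hc hα hA]
  exact Real.sqrt_le_sqrt
    (Triangulation.integral_energyDensity_le ho hc hα hA (S.grad_mem_feSpace v))

end Sampling

end Scheme

end RecoveryFEM

end

open MeasureTheory RecoveryFEM in
theorem mainTheorem2_general (α β : ℝ) (hα : 0 < α) (hβ : 0 < β) :
    ∃ c C : ℝ, 0 < c ∧ 0 < C ∧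
      ∀ (Ω : Set Plane), IsOpen Ω → Convex ℝ Ω →
      ∀ (A : Plane → Matrix (Fin 2) (Fin 2) ℝ), IsEllipticCoefficient Ω α β A →
      ∀ (𝒯 : Triangulation Ω) (S : Sampling 𝒯),
        ((∀ v ∈ S.spaceZeroZero, S.grad v = 0 → v = 0) →
          ∀ f : Plane → ℝ, IntegrableOn f Ω → ∃! u : Plane → ℝ, S.IsSolution A f u) ∧
        ∀ v ∈ S.spaceZeroZero,
          c * normJac Ω (S.grad v) ≤ S.energy A v ∧ S.energy A v ≤ C * normJac Ω (S.grad v) :=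
  ⟨Real.sqrt (α ^ 3 / (2 * β * (1 + α * β))), Real.sqrt (4 * β ^ 2 + 2),
    Real.sqrt_pos.2 (by positivity), Real.sqrt_pos.2 (by positivity),
    fun _ ho hc _ hA _ S => ⟨fun hS _ hf => S.existsUnique_isSolution ho hc hα hA hS hf,
      fun v hv => ⟨S.mul_normJac_le_energy ho hc hα hβ hA hv,
        S.energy_le_mul_normJac ho hc hα hA v⟩⟩⟩

open MeasureTheory RecoveryFEM in
theorem mainTheorem2 (α β ε : ℝ) (hα : 0 < α) (hβ : 0 < β) (hε : ε ∈ Set.Icc (0 : ℝ) 1) :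
    ∃ c C : ℝ, 0 < c ∧ 0 < C ∧
      ∀ (Ω : Set Plane), IsOpen Ω → Convex ℝ Ω → Bornology.IsBounded Ω →
      ∀ (A : Plane → Matrix (Fin 2) (Fin 2) ℝ), IsCordesCoefficient Ω α β ε A →
      ∀ (𝒯 : Triangulation Ω) (S : Sampling 𝒯), S.DiscretePoincare →
        (∀ f : Plane → ℝ, MemLp f 2 (volume.restrict Ω) → ∃! u : Plane → ℝ, S.IsSolution A f u) ∧
        ∀ v ∈ S.spaceZeroZero,
          c * normJac Ω (S.grad v) ≤ S.energy A v ∧ S.energy A v ≤ C * normJac Ω (S.grad v) := by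
  obtain ⟨c, C, hc, hC, h⟩ := mainTheorem2_general α β hα hβ
  refine ⟨c, C, hc, hC, fun Ω ho hconv _ A hA 𝒯 S hP => ?_⟩
  have := 𝒯.isFiniteMeasure_restrict
  obtain ⟨hsolve, henergy⟩ := h Ω ho hconv A hA.isEllipticCoefficient 𝒯 S
  exact ⟨fun f hf => hsolve (fun v hv => hP.eq_zero_of_grad_eq_zero ho hv.1) f
    (hf.integrable one_le_two), henergy⟩
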